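/- **Setting.** All objects are smooth. For a manifold $N$ with projection $\pi\colon TN\to N$ and a symmetric covariant 2-tensor $S$ on $N$, let $\theta_{v_a}=\pi^*(i_{v_a}S)$ be the Liouville form on $TN$, $\omega_S=d\theta$, and $T_S(v_a)=\tfrac12 S(v_a,v_a)$. For a 1-form $\tau$ on $N$ let $\dot\tau(v_a)=\langle\tau_a,v_a\rangle$. A second order differential equation is a vector field $D$ on $TN$ with $\pi_*(D_{v_a})=v_a$; its associated 1-form $\alpha$ with respect to $S$ is defined by $i_D\omega_S+dT_S+\alpha=0$, and $D$ is a geodesic field of $S$ when $\alpha=0$. Let $M$ be a finite-dimensional (Hausdorff) manifold with a pseudo-Riemannian (i.e. symmetric nondegenerate) metric $T_2$, and endow $\mathbb{R}\times M$ with the metric $\widetilde T_2=dt^2\oplus T_2$ and the time constraint $\dot t=1$ given by the 1-form $dt$. Let $(\varphi_t)_{t\in\mathbb{R}}$ be a one-parameter group of automorphisms of $M$ (that is, $(t,a)\mapsto\varphi_t(a)$ is smooth, $\varphi_0=\mathrm{Id}$, $\varphi_t\circ\varphi_s=\varphi_{t+s}$), and let $\varphi\colon\mathbb{R}\times M\to\mathbb{R}\times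 M$ be the diffeomorphism $\varphi(t,a)=(t,\varphi_t(a))$. Write $\varphi_*$ for its action on $T(\mathbb{R}\times M)$ by the tangent map, and $\varphi^*$ for the pull-back of forms on $T(\mathbb{R}\times M)$ by the tangent map. * $\varphi$ is *inertial* when the force caused by $\varphi$ is zero, i.e. when the geodesic field of $\varphi^*\widetilde T_2$ minus the geodesic field of $\widetilde T_2$ is zero on $T(\mathbb{R}\times M)$. * $\varphi$ *preserves the equations of motion* when $\varphi^*(dt)=dt$ and, for each second order differential equation $\overline D$ on $T(\mathbb{R}\times M)$ with $\overline D\,\dot t=0$, with associated 1-form $\overline\alpha$ with respect to $\widetilde T_2$, the vector field $D_1$ with $\varphi_*D_1=\overline D$ satisfies $$ i_{D_1}\omega_{\widetilde T_2}+dT_{\widetilde T_2}+\varphi^*(\overline\alpha)\equiv 0 \pmod{dt} \quad\text{on } T(\mathbb{R}\times M).$$ **Theorem.** $\varphi$ preserves the equations of motion if and only if $\varphi$ is inertial and each $\varphi_t\colon M\to M$ is an isometry of $(M,T_2)$, i.e. $\varphi_t^*T_2=T_2$ for all $t\in\mathbb{R}$. -/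

import Mathlib

open scoped Manifold ContDiff

noncomputable section

namespace InertialFrames

section General

variable {E : Type*} [NormedAddCommGroup E] [NormedSpace ℝ E]
  {H : Type*} [TopologicalSpace H] (I : ModelWithCorners ℝ E H)
  (M : Type*) [TopologicalSpace M] [ChartedSpace H M]

/-- A (rough) differential 1-form on `M`. -/
abbrev OneForm : Type _ := (x : M) → TangentSpace I x →L[ℝ] ℝ

/-- A (rough) covariant 2-tensor on `M`. -/
abbrev CovTensor2 : Type _ := (x : M) → TangentSpace I x →L[ℝ] TangentSpace I x →L[ℝ] ℝ

/-- A (rough) vector field on `M`. -/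
abbrev VField : Type _ := (x : M) → TangentSpace I x

/-- A smooth pseudo-Riemannian metric on `M`: a smooth field of symmetric nondegenerate bilinear
forms on the tangent spaces (no condition on the signature). -/
structure PseudoRiemannianMetric [IsManifold I ∞ M] where
  /-- the bilinear form on each tangent space -/
  val : CovTensor2 I M
  symm : ∀ (x : M) (v w : TangentSpace I x), val x v w = val x w v
  nondegenerate : ∀ (x : M) (v : TangentSpace I x),
    (∀ w : TangentSpace I x, val x v w = 0) → v = 0
  contMDiff : ContMDiff I (I.prod 𝓘(ℝ, E →L[ℝ] E →L[ℝ] ℝ)) ∞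
    (fun x ↦ Bundle.TotalSpace.mk' (E →L[ℝ] E →L[ℝ] ℝ)
      (E := fun x : M ↦ TangentSpace I x →L[ℝ] TangentSpace I x →L[ℝ] ℝ) x (val x))

variable {I M}

/-- The 1-form `i_v dη` at `x`, i.e. `w ↦ dη(v, w)`, where `dη` is the exterior derivative of the
1-form `η` on the boundaryless manifold `M`. In the chart `χ` at `x`, `η` becomes a 1-form `ηχ` on
the model vector space, and `d ηχ (a, b) = D ηχ (a) (b) - D ηχ (b) (a)`. -/
def contractExtDeriv [I.Boundaryless] (η : OneForm I M) (x : M) (v : TangentSpace I x) :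
    TangentSpace I x →L[ℝ] ℝ :=
  let χ := extChartAt I x
  let ηχ : E → E →L[ℝ] ℝ := fun y ↦ (η (χ.symm y)).comp (mfderiv 𝓘(ℝ, E) I χ.symm y)
  let A : E →L[ℝ] E →L[ℝ] ℝ := fderiv ℝ ηχ (χ x)
  let dχ : TangentSpace I x →L[ℝ] E := mfderiv I 𝓘(ℝ, E) χ x
  (A (dχ v) - A.flip (dχ v)).comp dχ

variable [IsManifold I ∞ M]

/-- The differential at `p : TM` of the projection `π : TM → M`. -/
def dProj (p : TangentBundle I M) : TangentSpace I.tangent p →L[ℝ] TangentSpace I p.1 :=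
  mfderiv I.tangent I (fun q : TangentBundle I M ↦ q.1) p

/-- The lift `π^*τ` to `TM` of a 1-form `τ` on `M`. -/
def liftForm (τ : OneForm I M) : OneForm I.tangent (TangentBundle I M) :=
  fun p ↦ (τ p.1).comp (dProj p)

/-- The function `τ̇` on `TM` defined by a 1-form `τ` on `M`: `τ̇(v_a) = τ_a(v_a)`. -/
def dotFun (τ : OneForm I M) (p : TangentBundle I M) : ℝ := τ p.1 p.2

/-- The differential of a function on `TM`, as a 1-form on `TM`. -/
def diffFun (f : TangentBundle I M → ℝ) : OneForm I.tangent (TangentBundle I M) :=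
  fun p ↦ mfderiv I.tangent 𝓘(ℝ, ℝ) f p

/-- The Liouville form on `TM` of a covariant 2-tensor `g` on `M`:
`θ_{v_a} = π^*(i_{v_a} g)`. -/
def liouvilleForm (g : CovTensor2 I M) : OneForm I.tangent (TangentBundle I M) :=
  fun p ↦ (g p.1 p.2).comp (dProj p)

/-- The kinetic energy `T(v_a) = g(v_a, v_a) / 2`. -/
def kineticEnergy (g : CovTensor2 I M) (p : TangentBundle I M) : ℝ := g p.1 p.2 p.2 / 2

/-- The 1-form `α` on `TM` associated by `g` to a vector field `D` on `TM`, that is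
`i_D ω₂ + dT + α = 0`, where `ω₂ = dθ`, `θ` is the Liouville form and `T` the kinetic energy. -/
def forceForm [I.Boundaryless] (g : CovTensor2 I M) (D : VField I.tangent (TangentBundle I M)) :
    OneForm I.tangent (TangentBundle I M) :=
  fun p ↦ -(contractExtDeriv (liouvilleForm g) p (D p) + diffFun (kineticEnergy g) p)

/-- A second order differential equation: a smooth vector field `D` on `TM` such that
`π_* (D_{v_a}) = v_a`. -/
structure IsSODE (D : VField I.tangent (TangentBundle I M)) : Prop where
  contMDiff : ContMDiff I.tangent I.tangent.tangent ∞
    (fun p ↦ (⟨p, D p⟩ : TangentBundle I.tangent (TangentBundle I M)))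
  proj : ∀ p : TangentBundle I M, dProj p (D p) = p.2

/-- `D` is the geodesic field of `g`: the second order differential equation with
`i_D ω₂ + dT = 0`. -/
def IsGeodesicField [I.Boundaryless] (g : CovTensor2 I M)
    (D : VField I.tangent (TangentBundle I M)) : Prop :=
  IsSODE D ∧ ∀ p, contractExtDeriv (liouvilleForm g) p (D p) + diffFun (kineticEnergy g) p = 0

end General

section Frames

variable {E : Type*} [NormedAddCommGroup E] [NormedSpace ℝ E]
  {H : Type*} [TopologicalSpace H] {I : ModelWithCorners ℝ E H}
  {R : Type*} [TopologicalSpace R] [ChartedSpace H R]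
  {F : Type*} [NormedAddCommGroup F] [NormedSpace ℝ F]
  {K : Type*} [TopologicalSpace K] {J : ModelWithCorners ℝ F K}
  {M : Type*} [TopologicalSpace M] [ChartedSpace K M]

/-- Pull-back `f^*g` of a covariant 2-tensor. -/
def pullbackTensor (I : ModelWithCorners ℝ E H) (J : ModelWithCorners ℝ F K)
    (f : R → M) (g : CovTensor2 J M) : CovTensor2 I R :=
  fun x ↦ (ContinuousLinearMap.precomp ℝ (mfderiv I J f x)).comp
    ((g (f x)).comp (mfderiv I J f x))

/-- Pull-back `f^*η` of a 1-form. -/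
def pullbackForm (I : ModelWithCorners ℝ E H) (J : ModelWithCorners ℝ F K)
    (f : R → M) (η : OneForm J M) : OneForm I R :=
  fun x ↦ (η (f x)).comp (mfderiv I J f x)

theorem pullbackTensor_apply (f : R → M) (g : CovTensor2 J M) (x : R) (v w : TangentSpace I x) :
    pullbackTensor I J f g x v w = g (f x) (mfderiv I J f x v) (mfderiv I J f x w) := rfl

variable [IsManifold I ∞ R] [IsManifold J ∞ M] [I.Boundaryless] [J.Boundaryless]

/-- `V` is the force caused by the reference frame `φ : R → M` for the metrics `gR`, `gM`:
the difference between the geodesic field of `φ^* gM` and the geodesic field of `gR`. -/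
def IsForceCausedBy (φ : R ≃ₘ⟮I, J⟯ M) (gR : CovTensor2 I R) (gM : CovTensor2 J M)
    (V : VField I.tangent (TangentBundle I R)) : Prop :=
  ∃ D₁ DG : VField I.tangent (TangentBundle I R),
    IsGeodesicField (pullbackTensor I J φ gM) D₁ ∧ IsGeodesicField gR DG ∧
      ∀ p, V p = D₁ p - DG p

/-- The reference frame `φ : R → M` is inertial: the force caused by `φ` is zero. -/
def IsInertial (φ : R ≃ₘ⟮I, J⟯ M) (gR : CovTensor2 I R) (gM : CovTensor2 J M) : Prop :=
  IsForceCausedBy φ gR gM (fun _ ↦ 0)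

/-- The vector field `D` on `TM` is the image by `φ` of the vector field `D₁` on `TR`:
`φ_* D₁ = D`, where `φ` acts from `TR` to `TM` by its tangent map. -/
def IsPushforward (φ : R ≃ₘ⟮I, J⟯ M) (D₁ : VField I.tangent (TangentBundle I R))
    (D : VField J.tangent (TangentBundle J M)) : Prop :=
  ∀ p : TangentBundle I R,
    mfderiv I.tangent J.tangent (tangentMap I J φ) p (D₁ p) = D (tangentMap I J φ p)

/-- The reference frame `φ : R → M` preserves the equations of motion, for the metrics `gR`, `gM`
and the time constraints `τ̇R = 1`, `τ̇M = 1`, where `τR`, `τM` are closed 1-forms without zeros: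
`φ^* τM = τR`, and for each second order differential equation `D` on `TM` with `D τ̇M = 0`, with
associated 1-form `α` (`i_D ω₂ + dT + α = 0` on `TM`), and for the field `D₁` on `TR` such that
`φ_* D₁ = D`, one has `i_{D₁} ω₂ + dT + φ^* α ≡ 0 mod (τR)` on `TR`. -/
def PreservesEquationsOfMotion (φ : R ≃ₘ⟮I, J⟯ M)
    (gR : CovTensor2 I R) (τR : OneForm I R) (gM : CovTensor2 J M) (τM : OneForm J M) : Prop :=
  pullbackForm I J φ τM = τR ∧
  ∀ D : VField J.tangent (TangentBundle J M), IsSODE D →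
    (∀ p, diffFun (dotFun τM) p (D p) = 0) →
    ∀ D₁ : VField I.tangent (TangentBundle I R), IsPushforward φ D₁ D →
      ∀ p : TangentBundle I R, ∃ c : ℝ,
        contractExtDeriv (liouvilleForm gR) p (D₁ p) + diffFun (kineticEnergy gR) p
          + pullbackForm I.tangent J.tangent (tangentMap I J φ) (forceForm gM D) p
          = c • liftForm τR p

end Frames

section OneParameterGroups

variable {E : Type*} [NormedAddCommGroup E] [NormedSpace ℝ E]
  {H : Type*} [TopologicalSpace H] (I : ModelWithCorners ℝ E H)
  (M : Type*) [TopologicalSpace M] [ChartedSpace H M]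

/-- A one-parameter group of automorphisms of `M`: a smooth action of `(ℝ, +)` on `M`. -/
structure OneParameterGroup where
  /-- the automorphism `φ_t` -/
  map : ℝ → M → M
  contMDiff : ContMDiff (𝓘(ℝ, ℝ).prod I) I ∞ (fun p : ℝ × M ↦ map p.1 p.2)
  map_zero : ∀ a, map 0 a = a
  map_add : ∀ s t a, map (s + t) a = map s (map t a)

variable {I M}

/-- The automorphism `(t, a) ↦ (t, φ_t(a))` of `ℝ × M`. -/
def OneParameterGroup.frame (φ : OneParameterGroup I M) :
    (ℝ × M) ≃ₘ⟮𝓘(ℝ, ℝ).prod I, 𝓘(ℝ, ℝ).prod I⟯ (ℝ × M) where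
  toFun p := (p.1, φ.map p.1 p.2)
  invFun p := (p.1, φ.map (-p.1) p.2)
  left_inv p := by simp [← φ.map_add, φ.map_zero]
  right_inv p := by simp [← φ.map_add, φ.map_zero]
  contMDiff_toFun := contMDiff_fst.prodMk φ.contMDiff
  contMDiff_invFun := contMDiff_fst.prodMk (φ.contMDiff.comp
    (((contDiff_neg.contMDiff).comp contMDiff_fst).prodMk contMDiff_snd))

variable (I M) in
/-- The 1-form `dt` on `ℝ × M`. -/
def dt : OneForm (𝓘(ℝ, ℝ).prod I) (ℝ × M) :=
  fun p ↦ mfderiv (𝓘(ℝ, ℝ).prod I) 𝓘(ℝ, ℝ) (fun q : ℝ × M ↦ q.1) p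

/-- The tensor `dt² ⊕ g` on `ℝ × M`. -/
def productMetric (g : CovTensor2 I M) : CovTensor2 (𝓘(ℝ, ℝ).prod I) (ℝ × M) :=
  fun p ↦ (dt I M p).smulRight (dt I M p)
    + pullbackTensor (𝓘(ℝ, ℝ).prod I) I (fun q : ℝ × M ↦ q.2) g p

end OneParameterGroups

end InertialFrames

end

open scoped Manifold ContDiff

noncomputable section

namespace InertialFrames

section ExtDeriv

open Filter Topology

variable {E : Type*} [NormedAddCommGroup E] [NormedSpace ℝ E]
  {H : Type*} [TopologicalSpace H] {I : ModelWithCorners ℝ E H}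
  {M : Type*} [TopologicalSpace M] [ChartedSpace H M]
  {V : Type*} [NormedAddCommGroup V] [NormedSpace ℝ V]

theorem fderiv_comp_fderiv_sub {ζ : V → V →L[ℝ] ℝ} {f : E → V} {y : E}
    (hf : ContDiffAt ℝ 2 f y) (hζ : DifferentiableAt ℝ ζ (f y)) (a b : E) :
    fderiv ℝ (fun z ↦ (ζ (f z)).comp (fderiv ℝ f z)) y a b
      - fderiv ℝ (fun z ↦ (ζ (f z)).comp (fderiv ℝ f z)) y b a
      = fderiv ℝ ζ (f y) (fderiv ℝ f y a) (fderiv ℝ f y b)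
        - fderiv ℝ ζ (f y) (fderiv ℝ f y b) (fderiv ℝ f y a) := by
  have h1 : HasFDerivAt (fun z ↦ ζ (f z)) ((fderiv ℝ ζ (f y)).comp (fderiv ℝ f y)) y :=
    hζ.hasFDerivAt.comp y (hf.differentiableAt (by norm_num)).hasFDerivAt
  have h2 : HasFDerivAt (fderiv ℝ f) (fderiv ℝ (fderiv ℝ f) y) y :=
    ((hf.fderiv_right (m := 1) (by norm_num)).differentiableAt (by norm_num)).hasFDerivAt
  have hs := (hf.isSymmSndFDerivAt (by simp)).eq a b
  rw [(h1.clm_comp h2).fderiv]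
  simp [hs]

variable [I.Boundaryless]

theorem contractExtDeriv_apply (η : OneForm I M) (x : M) (v w : TangentSpace I x) :
    contractExtDeriv η x v w
      = fderiv ℝ (fun y ↦ ((η ((extChartAt I x).symm y)).comp
            (mfderiv 𝓘(ℝ, E) I (extChartAt I x).symm y) : E →L[ℝ] ℝ)) (extChartAt I x x)
          (mvfderiv I (extChartAt I x) x v)
          (mvfderiv I (extChartAt I x) x w)
        - fderiv ℝ (fun y ↦ ((η ((extChartAt I x).symm y)).comp
            (mfderiv 𝓘(ℝ, E) I (extChartAt I x).symm y) : E →L[ℝ] ℝ)) (extChartAt I x x)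
          (mvfderiv I (extChartAt I x) x w)
          (mvfderiv I (extChartAt I x) x v) := rfl

theorem contractExtDeriv_apply_of_eventually_eq [IsManifold I ∞ M] {η : OneForm I M} {x : M}
    {F : M → V}
    {ζ : V → V →L[ℝ] ℝ} (hF : ContMDiffAt I 𝓘(ℝ, V) 2 F x) (hζ : DifferentiableAt ℝ ζ (F x))
    (h : ∀ᶠ z in 𝓝 x, ∀ v : TangentSpace I z, η z v = ζ (F z) (mvfderiv I F z v))
    (v w : TangentSpace I x) :
    contractExtDeriv η x v w
      = fderiv ℝ ζ (F x) (mvfderiv I F x v) (mvfderiv I F x w)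
        - fderiv ℝ ζ (F x) (mvfderiv I F x w) (mvfderiv I F x v) := by
  set χ := extChartAt I x with hχ
  have hsymm : ∀ y ∈ χ.target, MDifferentiableAt 𝓘(ℝ, E) I χ.symm y := fun y hy ↦
    (mdifferentiableWithinAt_extChartAt_symm hy).mdifferentiableAt
      (by rw [I.range_eq_univ]; exact univ_mem)
  have htgt : χ.target ∈ 𝓝 (χ x) := extChartAt_target_mem_nhds x
  have hcont : Tendsto χ.symm (𝓝 (χ x)) (𝓝 x) := by
    simpa [hχ] using (hsymm _ (mem_extChartAt_target x)).continuousAt.tendsto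
  set f : E → V := F ∘ χ.symm with hfdef
  have hfx : f (χ x) = F x := by simp [hfdef, hχ]
  have hf : ContDiffAt ℝ 2 f (χ x) := by
    have := (contMDiffAt_iff.1 hF).2
    rw [I.range_eq_univ, contDiffWithinAt_univ] at this
    exact this
  have hFd : ∀ᶠ z in 𝓝 x, MDifferentiableAt I 𝓘(ℝ, V) F z := by
    obtain ⟨u, hu, hFu⟩ := (contMDiffAt_iff_contMDiffOn_nhds (by simp)).1 hF
    filter_upwards [eventually_mem_nhds_iff.2 hu] with z hz
    exact (hFu.contMDiffAt hz).mdifferentiableAt (by simp)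
  have hη : (fun y ↦ (η (χ.symm y)).comp (mfderiv 𝓘(ℝ, E) I χ.symm y))
      =ᶠ[𝓝 (χ x)] fun y ↦ (ζ (f y)).comp (fderiv ℝ f y) := by
    filter_upwards [htgt, hcont.eventually h, hcont.eventually hFd] with y hy h1 h2
    ext a
    have := mfderiv_comp y h2 (hsymm y hy)
    rw [mfderiv_eq_fderiv] at this
    change η (χ.symm y) (mfderiv 𝓘(ℝ, E) I χ.symm y a) = ζ (f y) (fderiv ℝ f y a)
    rw [h1, mvfderiv, hfdef, this]
    rfl
  have hdf : ∀ u : TangentSpace I x, fderiv ℝ f (χ x) (mvfderiv I χ x u)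
      = mvfderiv I F x u := by
    intro u
    have h1 : HasMFDerivAt 𝓘(ℝ, E) 𝓘(ℝ, V) f (χ x) (fderiv ℝ f (χ x)) :=
      (hf.differentiableAt (by simp)).hasFDerivAt.hasMFDerivAt
    have h2 : HasMFDerivAt I 𝓘(ℝ, E) χ x (mfderiv I 𝓘(ℝ, E) χ x) :=
      (mdifferentiableAt_extChartAt (mem_chart_source H x)).hasMFDerivAt
    have h3 := (h1.comp x h2).congr_of_eventuallyEq (f₁ := F) (by
      filter_upwards [extChartAt_source_mem_nhds (I := I) x] with z hz
      exact congrArg F ((extChartAt I x).left_inv hz).symm)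
    rw [mvfderiv, mvfderiv, h3.mfderiv]
    rfl
  rw [contractExtDeriv_apply, hη.fderiv_eq, fderiv_comp_fderiv_sub hf (by rwa [hfx]), hfx, hdf, hdf]

theorem contractExtDeriv_sub (η : OneForm I M) (x : M) (v w : TangentSpace I x) :
    contractExtDeriv η x (v - w) = contractExtDeriv η x v - contractExtDeriv η x w := by
  refine ContinuousLinearMap.ext fun u ↦ ?_
  have h := map_sub (mvfderiv I (extChartAt I x) x) v w
  change _ = contractExtDeriv η x v u - contractExtDeriv η x w u
  simp only [contractExtDeriv_apply]
  rw [h]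
  set A := fderiv ℝ (fun y ↦ ((η ((extChartAt I x).symm y)).comp
    (mfderiv 𝓘(ℝ, E) I (extChartAt I x).symm y) : E →L[ℝ] ℝ)) (extChartAt I x x)
  have key : ∀ a b c : E, A (a - b) c - A c (a - b) = A a c - A c a - (A b c - A c b) := by
    intro a b c
    rw [map_sub, map_sub, sub_apply]
    ring
  exact key _ _ _

end ExtDeriv

section TangentCoordinates

open Filter Topology

variable {E : Type*} [NormedAddCommGroup E] [NormedSpace ℝ E]
  {H : Type*} [TopologicalSpace H] {I : ModelWithCorners ℝ E H}
  {M : Type*} [TopologicalSpace M] [ChartedSpace H M]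
  {F : Type*} [NormedAddCommGroup F] [NormedSpace ℝ F]
  {K : Type*} [TopologicalSpace K] {J : ModelWithCorners ℝ F K}
  {R : Type*} [TopologicalSpace R] [ChartedSpace K R]
  {V W : Type*} [NormedAddCommGroup V] [NormedSpace ℝ V] [NormedAddCommGroup W] [NormedSpace ℝ W]

theorem mvfderiv_comp_mfderiv {g : M → V} {f : R → M} {x : R}
    (hg : MDifferentiableAt I 𝓘(ℝ, V) g (f x)) (hf : MDifferentiableAt J I f x)
    (v : TangentSpace J x) :
    mvfderiv J (fun z ↦ g (f z)) x v = mvfderiv I g (f x) (mfderiv J I f x v) :=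
  congrArg (fun A ↦ A v) (mfderiv_comp x hg hf)

theorem mvfderiv_fderiv_comp {g : V → W} {f : R → V} {x : R}
    (hg : DifferentiableAt ℝ g (f x)) (hf : MDifferentiableAt J 𝓘(ℝ, V) f x)
    (v : TangentSpace J x) :
    mvfderiv J (fun z ↦ g (f z)) x v = fderiv ℝ g (f x) (mvfderiv J f x v) := by
  have h := mfderiv_comp x hg.mdifferentiableAt hf
  rw [mfderiv_eq_fderiv] at h
  exact congrArg (fun A ↦ A v) h

theorem mvfderiv_congr {f g : M → V} {x : M} (h : f =ᶠ[𝓝 x] g) :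
    mvfderiv I f x = mvfderiv I g x := by
  ext v
  exact congrArg (fun A : TangentSpace I x →L[ℝ] V ↦ A v) h.mfderiv_eq

variable [IsManifold I ∞ M]

theorem isInvertible_mvfderiv_extChartAt {x₀ x : M} (hx : x ∈ (chartAt H x₀).source) :
    (mvfderiv I (extChartAt I x₀) x).IsInvertible :=
  isInvertible_mfderiv_extChartAt (by rwa [extChartAt_source])

variable (I) in
/-- The coordinates of the tangent bundle given by the chart of `M` at `x₀`. -/
def tangentCoord (x₀ : M) (p : TangentBundle I M) : E × E :=
  (extChartAt I x₀ p.1, mvfderiv I (extChartAt I x₀) p.1 p.2)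

theorem trivializationAt_snd_eq {x₀ : M} {p : TangentBundle I M}
    (h : p.1 ∈ (chartAt H x₀).source) :
    (trivializationAt E (TangentSpace I) x₀ p).2 = mvfderiv I (extChartAt I x₀) p.1 p.2 := by
  have h1 := TangentBundle.continuousLinearMapAt_trivializationAt (I := I) h
  have h2 : (trivializationAt E (TangentSpace I) x₀).continuousLinearMapAt ℝ p.1 p.2
      = (trivializationAt E (TangentSpace I) x₀ p).2 := by
    rw [Bundle.Trivialization.continuousLinearMapAt_apply,
      Bundle.Trivialization.coe_linearMapAt_of_mem _ (by simpa using h)]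
  exact h2.symm.trans (congrArg (fun A ↦ A p.2) h1)

theorem tangentCoord_eq_extChartAt {q p : TangentBundle I M}
    (h : p.1 ∈ (chartAt H q.1).source) :
    tangentCoord I q.1 p = extChartAt I.tangent q p := by
  rw [FiberBundle.extChartAt]
  exact Prod.ext rfl (trivializationAt_snd_eq h).symm

theorem mem_nhds_proj_source {x₀ : M} {p : TangentBundle I M}
    (h : p.1 ∈ (chartAt H x₀).source) :
    ∀ᶠ q : TangentBundle I M in 𝓝 p, q.1 ∈ (chartAt H x₀).source :=
  (FiberBundle.continuous_proj E (TangentSpace I)).continuousAt.eventually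
    ((chartAt H x₀).open_source.mem_nhds h)

theorem tangentCoord_eventuallyEq {q p : TangentBundle I M}
    (h : p.1 ∈ (chartAt H q.1).source) :
    tangentCoord I q.1 =ᶠ[𝓝 p] extChartAt I.tangent q := by
  filter_upwards [mem_nhds_proj_source h] with z hz using tangentCoord_eq_extChartAt hz

theorem contMDiffAt_tangentCoord {x₀ : M} {p : TangentBundle I M}
    (h : p.1 ∈ (chartAt H x₀).source) :
    ContMDiffAt I.tangent 𝓘(ℝ, E × E) ∞ (tangentCoord I x₀) p := by
  let q : TangentBundle I M := ⟨x₀, 0⟩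
  have h1 : ContMDiffAt I.tangent 𝓘(ℝ, E × E) ∞ (extChartAt I.tangent q) p :=
    contMDiffAt_extChartAt' ((TangentBundle.mem_chart_source_iff p q).2 h)
  exact h1.congr_of_eventuallyEq (tangentCoord_eventuallyEq (q := q) h)

theorem isInvertible_mvfderiv_tangentCoord {x₀ : M} {p : TangentBundle I M}
    (h : p.1 ∈ (chartAt H x₀).source) :
    (mvfderiv I.tangent (tangentCoord I x₀) p).IsInvertible := by
  let q : TangentBundle I M := ⟨x₀, 0⟩
  rw [mvfderiv_congr (tangentCoord_eventuallyEq (q := q) h)]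
  exact isInvertible_mvfderiv_extChartAt ((TangentBundle.mem_chart_source_iff p q).2 h)

theorem mdifferentiable_tangentBundle_proj :
    MDifferentiable I.tangent I (fun q : TangentBundle I M ↦ q.1) :=
  (Bundle.contMDiff_proj (n := ∞) (TangentSpace I)).mdifferentiable (by simp)

theorem mvfderiv_tangentCoord_fst {x₀ : M} {p : TangentBundle I M}
    (h : p.1 ∈ (chartAt H x₀).source) (ξ : TangentSpace I.tangent p) :
    (mvfderiv I.tangent (tangentCoord I x₀) p ξ).1
      = mvfderiv I (extChartAt I x₀) p.1 (dProj p ξ) := by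
  have h1 := mvfderiv_fderiv_comp (g := (Prod.fst : E × E → E)) (f := tangentCoord I x₀)
    differentiableAt_fst ((contMDiffAt_tangentCoord h).mdifferentiableAt (by simp)) ξ
  rw [fderiv_fst] at h1
  exact h1.symm.trans (mvfderiv_comp_mfderiv (mdifferentiableAt_extChartAt h)
    (mdifferentiable_tangentBundle_proj p) ξ)

/-- The vector tangent at `p` to the fibre of `TM`, defined by a vector `Y` at the base point. -/
def verticalLift (p : TangentBundle I M) (Y : TangentSpace I p.1) : TangentSpace I.tangent p :=
  mfderiv 𝓘(ℝ, E) I.tangent (fun v : E ↦ (⟨p.1, v⟩ : TangentBundle I M)) p.2 Y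

theorem mdifferentiable_fibre_inclusion (x : M) :
    MDifferentiable 𝓘(ℝ, E) I.tangent (fun v : E ↦ (⟨x, v⟩ : TangentBundle I M)) := by
  intro v
  refine ContMDiffAt.mdifferentiableAt (n := ∞) ?_ (by simp)
  rw [Bundle.contMDiffAt_totalSpace]
  refine ⟨contMDiffAt_const, ?_⟩
  let L : E →L[ℝ] E := mvfderiv I (extChartAt I x) x
  have h : ContMDiffAt 𝓘(ℝ, E) 𝓘(ℝ, E) ∞ L v := L.contDiff.contDiffAt.contMDiffAt
  refine h.congr_of_eventuallyEq (Eventually.of_forall fun u ↦ ?_)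
  exact trivializationAt_snd_eq (p := ⟨x, u⟩) (mem_chart_source H x)

theorem mvfderiv_tangentCoord_verticalLift {x₀ : M} {p : TangentBundle I M}
    (h : p.1 ∈ (chartAt H x₀).source) (Y : TangentSpace I p.1) :
    mvfderiv I.tangent (tangentCoord I x₀) p (verticalLift p Y)
      = (0, mvfderiv I (extChartAt I x₀) p.1 Y) := by
  let L : E →L[ℝ] E := mvfderiv I (extChartAt I x₀) p.1
  let u : E := p.2
  have h2 : HasFDerivAt (fun v : E ↦ (extChartAt I x₀ p.1, L v)) ((0 : E →L[ℝ] E).prod L) u :=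
    (hasFDerivAt_const _ _).prodMk L.hasFDerivAt
  have h1 := mvfderiv_comp_mfderiv (J := 𝓘(ℝ, E)) (g := tangentCoord I x₀)
    (f := fun v : E ↦ (⟨p.1, v⟩ : TangentBundle I M)) (x := u)
    ((contMDiffAt_tangentCoord h).mdifferentiableAt (by simp))
    (mdifferentiable_fibre_inclusion p.1 u) Y
  exact h1.symm.trans (congrArg (fun A ↦ A Y) h2.hasMFDerivAt.mfderiv)

theorem verticalLift_zero (p : TangentBundle I M) : verticalLift p 0 = 0 :=
  let u : E := p.2
  map_zero (mfderiv 𝓘(ℝ, E) I.tangent (fun v : E ↦ (⟨p.1, v⟩ : TangentBundle I M)) u)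

theorem exists_verticalLift_eq {p : TangentBundle I M} {Δ : TangentSpace I.tangent p}
    (h : dProj p Δ = 0) : ∃ Y, Δ = verticalLift p Y := by
  have hp := mem_chart_source H p.1
  obtain ⟨Y, hY⟩ := (isInvertible_mvfderiv_extChartAt (I := I) hp).bijective.2
    (mvfderiv I.tangent (tangentCoord I p.1) p Δ).2
  refine ⟨Y, (isInvertible_mvfderiv_tangentCoord hp).bijective.1 ?_⟩
  rw [mvfderiv_tangentCoord_verticalLift hp, hY]
  refine Prod.ext ?_ rfl
  rw [mvfderiv_tangentCoord_fst hp, h, map_zero]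

theorem dProj_surjective (p : TangentBundle I M) : Function.Surjective (dProj p) := by
  intro w
  have hp := mem_chart_source H p.1
  obtain ⟨ξ, hξ⟩ := (isInvertible_mvfderiv_tangentCoord hp).bijective.2
    (mvfderiv I (extChartAt I p.1) p.1 w, 0)
  refine ⟨ξ, (isInvertible_mvfderiv_extChartAt hp).bijective.1 ?_⟩
  rw [← mvfderiv_tangentCoord_fst hp, hξ]

variable [IsManifold J ∞ R]

theorem mdifferentiable_tangentMap {φ : R → M} (hφ : ContMDiff J I ∞ φ) :
    MDifferentiable J.tangent I.tangent (tangentMap J I φ) :=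
  (hφ.contMDiff_tangentMap (m := ∞) (by simp)).mdifferentiable (by simp)

theorem dProj_mfderiv_tangentMap {φ : R → M} (hφ : ContMDiff J I ∞ φ) (p : TangentBundle J R)
    (ξ : TangentSpace J.tangent p) :
    dProj (tangentMap J I φ p) (mfderiv J.tangent I.tangent (tangentMap J I φ) p ξ)
      = mfderiv J I φ p.1 (dProj p ξ) := by
  have h1 := mfderiv_comp p (mdifferentiable_tangentBundle_proj (I := I) (tangentMap J I φ p))
    (mdifferentiable_tangentMap hφ p)
  have h2 := mfderiv_comp p (hφ.mdifferentiable (by simp) p.1)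
    (mdifferentiable_tangentBundle_proj (I := J) p)
  exact congrArg (fun A ↦ A ξ) (h1.symm.trans h2)

theorem mfderiv_tangentMap_verticalLift {φ : R → M} (hφ : ContMDiff J I ∞ φ)
    (p : TangentBundle J R) (Y : TangentSpace J p.1) :
    mfderiv J.tangent I.tangent (tangentMap J I φ) p (verticalLift p Y)
      = verticalLift (tangentMap J I φ p) (mfderiv J I φ p.1 Y) := by
  let L : F →L[ℝ] E := mfderiv J I φ p.1
  let u : F := p.2
  have h1 := mfderiv_comp (I := 𝓘(ℝ, F)) (f := fun v : F ↦ (⟨p.1, v⟩ : TangentBundle J R)) u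
    (mdifferentiable_tangentMap hφ p) (mdifferentiable_fibre_inclusion p.1 u)
  have h2 := mfderiv_comp (I := 𝓘(ℝ, F)) (I' := 𝓘(ℝ, E)) (f := L) u
    (mdifferentiable_fibre_inclusion (I := I) (φ p.1) (L u)) L.mdifferentiableAt
  rw [ContinuousLinearMap.mfderiv_eq] at h2
  exact congrArg (fun A ↦ A Y) (h1.symm.trans h2)

end TangentCoordinates

section LagrangeForms

open Filter Topology

variable {E : Type*} [NormedAddCommGroup E] [NormedSpace ℝ E]
  {H : Type*} [TopologicalSpace H] {I : ModelWithCorners ℝ E H}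
  {M : Type*} [TopologicalSpace M] [ChartedSpace H M]
  {F : Type*} [NormedAddCommGroup F] [NormedSpace ℝ F]
  {K : Type*} [TopologicalSpace K] {J : ModelWithCorners ℝ F K}
  {R : Type*} [TopologicalSpace R] [ChartedSpace K R]

/-- `G` is the expression of the covariant 2-tensor `g` in the chart at `x₀`, and it is smooth. -/
structure IsLocalRep (g : CovTensor2 I M) (x₀ : M) (G : E → E →L[ℝ] E →L[ℝ] ℝ) : Prop where
  contDiffOn : ContDiffOn ℝ ∞ G (extChartAt I x₀).target
  eq : ∀ x ∈ (chartAt H x₀).source, ∀ v w : TangentSpace I x,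
    g x v w = G (extChartAt I x₀ x) (mvfderiv I (extChartAt I x₀) x v)
      (mvfderiv I (extChartAt I x₀) x w)

/-- A covariant 2-tensor is smooth if its expressions in the charts are smooth. -/
def IsSmoothTensor (g : CovTensor2 I M) : Prop := ∀ x₀, ∃ G, IsLocalRep g x₀ G

/-- The Liouville form on `E × E` of a field of bilinear forms on `E`. -/
def liouvilleRep (G : E → E →L[ℝ] E →L[ℝ] ℝ) (z : E × E) : E × E →L[ℝ] ℝ :=
  (G z.1 z.2).comp (ContinuousLinearMap.fst ℝ E E)

theorem hasFDerivAt_eval_snd {G : E → E →L[ℝ] E →L[ℝ] ℝ} {z : E × E}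
    (hG : DifferentiableAt ℝ G z.1) :
    HasFDerivAt (fun z : E × E ↦ G z.1 z.2)
      ((G z.1).comp (ContinuousLinearMap.snd ℝ E E)
        + ((fderiv ℝ G z.1).comp (ContinuousLinearMap.fst ℝ E E)).flip z.2) z :=
  (hG.hasFDerivAt.comp z hasFDerivAt_fst).clm_apply hasFDerivAt_snd

theorem hasFDerivAt_liouvilleRep {G : E → E →L[ℝ] E →L[ℝ] ℝ} {z : E × E}
    (hG : DifferentiableAt ℝ G z.1) :
    HasFDerivAt (liouvilleRep G)
      ((ContinuousLinearMap.precomp ℝ (ContinuousLinearMap.fst ℝ E E)).comp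
        ((G z.1).comp (ContinuousLinearMap.snd ℝ E E)
        + ((fderiv ℝ G z.1).comp (ContinuousLinearMap.fst ℝ E E)).flip z.2)) z :=
  HasFDerivAt.comp (g := fun A : E →L[ℝ] ℝ ↦ A.comp (ContinuousLinearMap.fst ℝ E E)) z
    (ContinuousLinearMap.hasFDerivAt
      (ContinuousLinearMap.precomp ℝ (ContinuousLinearMap.fst ℝ E E)))
    (hasFDerivAt_eval_snd hG)

theorem fderiv_liouvilleRep_apply {G : E → E →L[ℝ] E →L[ℝ] ℝ} {z : E × E}
    (hG : DifferentiableAt ℝ G z.1) (a b : E × E) :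
    fderiv ℝ (liouvilleRep G) z a b = G z.1 a.2 b.1 + fderiv ℝ G z.1 a.1 z.2 b.1 := by
  rw [(hasFDerivAt_liouvilleRep hG).fderiv]
  simp

/-- The kinetic energy on `E × E` of a field of bilinear forms on `E`. -/
def kineticRep (G : E → E →L[ℝ] E →L[ℝ] ℝ) (z : E × E) : ℝ := G z.1 z.2 z.2 / 2

theorem hasFDerivAt_kineticRep {G : E → E →L[ℝ] E →L[ℝ] ℝ} {z : E × E}
    (hG : DifferentiableAt ℝ G z.1) :
    HasFDerivAt (kineticRep G) ((2⁻¹ : ℝ) • ((G z.1 z.2).comp (ContinuousLinearMap.snd ℝ E E)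
      + (((G z.1).comp (ContinuousLinearMap.snd ℝ E E)
        + ((fderiv ℝ G z.1).comp (ContinuousLinearMap.fst ℝ E E)).flip z.2)).flip z.2)) z := by
  have h := ((hasFDerivAt_eval_snd hG).clm_apply hasFDerivAt_snd).const_mul (2⁻¹ : ℝ)
  refine h.congr_of_eventuallyEq (Eventually.of_forall fun y ↦ ?_)
  rw [kineticRep, div_eq_inv_mul]

theorem fderiv_kineticRep_apply {G : E → E →L[ℝ] E →L[ℝ] ℝ} {z : E × E}
    (hG : DifferentiableAt ℝ G z.1) (a : E × E) :
    fderiv ℝ (kineticRep G) z a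
      = (G z.1 z.2 a.2 + G z.1 a.2 z.2 + fderiv ℝ G z.1 a.1 z.2 z.2) / 2 := by
  rw [(hasFDerivAt_kineticRep hG).fderiv]
  simp
  ring

variable {g : CovTensor2 I M} {x₀ : M} {G : E → E →L[ℝ] E →L[ℝ] ℝ}

theorem kineticEnergy_eq (hG : IsLocalRep g x₀ G) {p : TangentBundle I M}
    (hp : p.1 ∈ (chartAt H x₀).source) :
    kineticEnergy g p = kineticRep G (tangentCoord I x₀ p) :=
  congrArg (fun t ↦ t / 2) (hG.eq p.1 hp p.2 p.2)

theorem IsLocalRep.contDiffAt [I.Boundaryless] (hG : IsLocalRep g x₀ G) {x : M}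
    (hx : x ∈ (chartAt H x₀).source) : ContDiffAt ℝ ∞ G (extChartAt I x₀ x) := by
  rw [← extChartAt_source I] at hx
  exact hG.contDiffOn.contDiffAt
    ((isOpen_extChartAt_target x₀).mem_nhds ((extChartAt I x₀).map_source hx))

theorem IsLocalRep.differentiableAt [I.Boundaryless] (hG : IsLocalRep g x₀ G) {x : M}
    (hx : x ∈ (chartAt H x₀).source) : DifferentiableAt ℝ G (extChartAt I x₀ x) :=
  (hG.contDiffAt hx).differentiableAt (by simp)

variable [IsManifold I ∞ M]

theorem liouvilleForm_apply_eq (hG : IsLocalRep g x₀ G) {p : TangentBundle I M}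
    (hp : p.1 ∈ (chartAt H x₀).source) (ξ : TangentSpace I.tangent p) :
    liouvilleForm g p ξ
      = liouvilleRep G (tangentCoord I x₀ p) (mvfderiv I.tangent (tangentCoord I x₀) p ξ) := by
  refine (hG.eq p.1 hp p.2 (dProj p ξ)).trans ?_
  rw [← mvfderiv_tangentCoord_fst hp]
  rfl

theorem kineticEnergy_eventuallyEq (hG : IsLocalRep g x₀ G) {p : TangentBundle I M}
    (hp : p.1 ∈ (chartAt H x₀).source) :
    kineticEnergy g =ᶠ[𝓝 p] fun q ↦ kineticRep G (tangentCoord I x₀ q) := by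
  filter_upwards [mem_nhds_proj_source hp] with q hq using kineticEnergy_eq hG hq

theorem mdifferentiableAt_tangentCoord {p : TangentBundle I M}
    (hp : p.1 ∈ (chartAt H x₀).source) :
    MDifferentiableAt I.tangent 𝓘(ℝ, E × E) (tangentCoord I x₀) p :=
  (contMDiffAt_tangentCoord hp).mdifferentiableAt (by simp)

variable [I.Boundaryless]

theorem contractExtDeriv_liouvilleForm (hG : IsLocalRep g x₀ G) {p : TangentBundle I M}
    (hp : p.1 ∈ (chartAt H x₀).source) (ξ η : TangentSpace I.tangent p) :
    contractExtDeriv (liouvilleForm g) p ξ η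
      = fderiv ℝ (liouvilleRep G) (tangentCoord I x₀ p)
          (mvfderiv I.tangent (tangentCoord I x₀) p ξ)
          (mvfderiv I.tangent (tangentCoord I x₀) p η)
        - fderiv ℝ (liouvilleRep G) (tangentCoord I x₀ p)
          (mvfderiv I.tangent (tangentCoord I x₀) p η)
          (mvfderiv I.tangent (tangentCoord I x₀) p ξ) := by
  refine contractExtDeriv_apply_of_eventually_eq
    ((contMDiffAt_tangentCoord hp).of_le ENat.LEInfty.out)
    (hasFDerivAt_liouvilleRep (hG.differentiableAt hp)).differentiableAt ?_ ξ η
  filter_upwards [mem_nhds_proj_source hp] with q hq ζ using liouvilleForm_apply_eq hG hq ζ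

theorem mdifferentiableAt_kineticEnergy (hg : IsSmoothTensor g) (p : TangentBundle I M) :
    MDifferentiableAt I.tangent 𝓘(ℝ, ℝ) (kineticEnergy g) p := by
  obtain ⟨G, hG⟩ := hg p.1
  have hp := mem_chart_source H p.1
  exact (MDifferentiableAt.comp (g := kineticRep G) (f := tangentCoord I p.1) p
    (hasFDerivAt_kineticRep (hG.differentiableAt hp)).differentiableAt.mdifferentiableAt
    (mdifferentiableAt_tangentCoord hp)).congr_of_eventuallyEq (kineticEnergy_eventuallyEq hG hp)

theorem diffFun_kineticEnergy_apply (hG : IsLocalRep g x₀ G) {p : TangentBundle I M}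
    (hp : p.1 ∈ (chartAt H x₀).source) (ξ : TangentSpace I.tangent p) :
    diffFun (kineticEnergy g) p ξ = fderiv ℝ (kineticRep G) (tangentCoord I x₀ p)
      (mvfderiv I.tangent (tangentCoord I x₀) p ξ) := by
  rw [← mvfderiv_fderiv_comp (hasFDerivAt_kineticRep (hG.differentiableAt hp)).differentiableAt
    (mdifferentiableAt_tangentCoord hp), ← mvfderiv_congr (kineticEnergy_eventuallyEq hG hp)]
  rfl

/-- The 1-form `i_d ω₂ + dT` at `p`. -/
def eulerForm (g : CovTensor2 I M) (p : TangentBundle I M) (d : TangentSpace I.tangent p) :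
    TangentSpace I.tangent p →L[ℝ] ℝ :=
  contractExtDeriv (liouvilleForm g) p d + diffFun (kineticEnergy g) p

theorem eulerForm_apply (g : CovTensor2 I M) (p : TangentBundle I M)
    (d ξ : TangentSpace I.tangent p) : eulerForm g p d ξ
      = contractExtDeriv (liouvilleForm g) p d ξ + diffFun (kineticEnergy g) p ξ := rfl

theorem eulerForm_sub (g : CovTensor2 I M) (p : TangentBundle I M)
    (d e : TangentSpace I.tangent p) :
    eulerForm g p d - eulerForm g p e = contractExtDeriv (liouvilleForm g) p (d - e) := by
  rw [contractExtDeriv_sub, eulerForm, eulerForm, add_sub_add_right_eq_sub]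

/-- The Lagrange equations in coordinates. -/
theorem eulerForm_apply_eq (hG : IsLocalRep g x₀ G) (hg : ∀ x v w, g x v w = g x w v)
    {p : TangentBundle I M} (hp : p.1 ∈ (chartAt H x₀).source)
    {d : TangentSpace I.tangent p} (hd : dProj p d = p.2) (ξ : TangentSpace I.tangent p) :
    eulerForm g p d ξ
      = G (extChartAt I x₀ p.1) (mvfderiv I.tangent (tangentCoord I x₀) p d).2
          (mvfderiv I (extChartAt I x₀) p.1 (dProj p ξ))
        + fderiv ℝ G (extChartAt I x₀ p.1) (mvfderiv I (extChartAt I x₀) p.1 p.2)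
          (mvfderiv I (extChartAt I x₀) p.1 p.2) (mvfderiv I (extChartAt I x₀) p.1 (dProj p ξ))
        - fderiv ℝ G (extChartAt I x₀ p.1) (mvfderiv I (extChartAt I x₀) p.1 (dProj p ξ))
          (mvfderiv I (extChartAt I x₀) p.1 p.2) (mvfderiv I (extChartAt I x₀) p.1 p.2) / 2 := by
  have hsymm : ∀ a b : E, G (extChartAt I x₀ p.1) a b = G (extChartAt I x₀ p.1) b a := by
    intro a b
    obtain ⟨v, rfl⟩ := (isInvertible_mvfderiv_extChartAt (I := I) hp).bijective.2 a
    obtain ⟨w, rfl⟩ := (isInvertible_mvfderiv_extChartAt (I := I) hp).bijective.2 b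
    rw [← hG.eq _ hp, ← hG.eq _ hp, hg]
  have hd' := mvfderiv_tangentCoord_fst hp d
  rw [hd] at hd'
  rw [eulerForm_apply, contractExtDeriv_liouvilleForm hG hp, diffFun_kineticEnergy_apply hG hp,
    fderiv_liouvilleRep_apply (hG.differentiableAt hp),
    fderiv_liouvilleRep_apply (hG.differentiableAt hp),
    fderiv_kineticRep_apply (hG.differentiableAt hp), hd', mvfderiv_tangentCoord_fst hp]
  simp only [tangentCoord]
  rw [hsymm (mvfderiv I (extChartAt I x₀) p.1 p.2)]
  ring

theorem contractExtDeriv_verticalLift (hg : IsSmoothTensor g) (p : TangentBundle I M)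
    (Y : TangentSpace I p.1) (ξ : TangentSpace I.tangent p) :
    contractExtDeriv (liouvilleForm g) p (verticalLift p Y) ξ = g p.1 Y (dProj p ξ) := by
  obtain ⟨G, hG⟩ := hg p.1
  have hp := mem_chart_source H p.1
  rw [contractExtDeriv_liouvilleForm hG hp, fderiv_liouvilleRep_apply (hG.differentiableAt hp),
    fderiv_liouvilleRep_apply (hG.differentiableAt hp), mvfderiv_tangentCoord_verticalLift hp,
    mvfderiv_tangentCoord_fst hp, hG.eq p.1 hp]
  simp [tangentCoord]

variable [IsManifold J ∞ R] [J.Boundaryless]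

theorem contractExtDeriv_liouvilleForm_pullback (hg : IsSmoothTensor g) {φ : R → M}
    (hφ : ContMDiff J I ∞ φ) (p : TangentBundle J R) (ξ η : TangentSpace J.tangent p) :
    contractExtDeriv (liouvilleForm (pullbackTensor J I φ g)) p ξ η
      = contractExtDeriv (liouvilleForm g) (tangentMap J I φ p)
          (mfderiv J.tangent I.tangent (tangentMap J I φ) p ξ)
          (mfderiv J.tangent I.tangent (tangentMap J I φ) p η) := by
  obtain ⟨G, hG⟩ := hg (φ p.1)
  have hp : (tangentMap J I φ p).1 ∈ (chartAt H (φ p.1)).source := mem_chart_source H (φ p.1)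
  have hT := hφ.contMDiff_tangentMap (m := ∞) (by simp)
  rw [contractExtDeriv_liouvilleForm hG hp]
  rw [← mvfderiv_comp_mfderiv (mdifferentiableAt_tangentCoord hp) (mdifferentiable_tangentMap hφ p),
    ← mvfderiv_comp_mfderiv (mdifferentiableAt_tangentCoord hp) (mdifferentiable_tangentMap hφ p)]
  refine contractExtDeriv_apply_of_eventually_eq (F := fun z ↦ tangentCoord I (φ p.1)
      (tangentMap J I φ z)) (ContMDiffAt.of_le
      (ContMDiffAt.comp p (contMDiffAt_tangentCoord hp) (hT p)) ENat.LEInfty.out)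
    (hasFDerivAt_liouvilleRep (hG.differentiableAt hp)).differentiableAt ?_ ξ η
  filter_upwards [hT.continuous.continuousAt.eventually (mem_nhds_proj_source hp)] with q hq ζ
  rw [mvfderiv_comp_mfderiv (mdifferentiableAt_tangentCoord hq) (mdifferentiable_tangentMap hφ q),
    ← liouvilleForm_apply_eq hG hq]
  change g (φ q.1) (mfderiv J I φ q.1 q.2) (mfderiv J I φ q.1 (dProj q ζ)) = _
  rw [← dProj_mfderiv_tangentMap hφ]
  rfl

theorem eulerForm_pullback (hg : IsSmoothTensor g) {φ : R → M}
    (hφ : ContMDiff J I ∞ φ) (p : TangentBundle J R) (d ξ : TangentSpace J.tangent p) :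
    eulerForm (pullbackTensor J I φ g) p d ξ
      = eulerForm g (tangentMap J I φ p)
          (mfderiv J.tangent I.tangent (tangentMap J I φ) p d)
          (mfderiv J.tangent I.tangent (tangentMap J I φ) p ξ) := by
  rw [eulerForm_apply, eulerForm_apply, contractExtDeriv_liouvilleForm_pullback hg hφ]
  congr 1
  exact congrArg (fun A ↦ A ξ) (mfderiv_comp p
    (mdifferentiableAt_kineticEnergy hg (tangentMap J I φ p)) (mdifferentiable_tangentMap hφ p))

end LagrangeForms

section NewtonFields

open Filter Topology

variable {E : Type*} [NormedAddCommGroup E] [NormedSpace ℝ E]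
  {H : Type*} [TopologicalSpace H] {I : ModelWithCorners ℝ E H}
  {M : Type*} [TopologicalSpace M] [ChartedSpace H M]
  {g : CovTensor2 I M} {x₀ : M} {G : E → E →L[ℝ] E →L[ℝ] ℝ}

/-- The covector `c` such that the equations of motion in coordinates, in the potential `u`,
are `G a = c`, where `a` is the acceleration. -/
def accelerationForm (G : E → E →L[ℝ] E →L[ℝ] ℝ) (u : E → ℝ) (z : E × E) : E →L[ℝ] ℝ :=
  (2⁻¹ : ℝ) • ((fderiv ℝ G z.1).flip z.2).flip z.2 - fderiv ℝ G z.1 z.2 z.2 - fderiv ℝ u z.1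

set_option maxSynthPendingDepth 3 in
theorem contDiffAt_accelerationForm {u : E → ℝ} {z : E × E} (hG : ContDiffAt ℝ ∞ G z.1)
    (hu : ContDiffAt ℝ ∞ u z.1) : ContDiffAt ℝ ∞ (accelerationForm G u) z := by
  have h1 : ContDiffAt ℝ ∞ (fun z : E × E ↦ fderiv ℝ G z.1) z :=
    ContDiffAt.comp z (hG.fderiv_right (m := ∞) (by simp)) contDiffAt_fst
  have h2 : ContDiffAt ℝ ∞ (fun z : E × E ↦ fderiv ℝ u z.1) z :=
    ContDiffAt.comp z (hu.fderiv_right (m := ∞) (by simp)) contDiffAt_fst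
  have hs : ContDiffAt ℝ ∞ (fun z : E × E ↦ z.2) z := contDiffAt_snd
  have hflip : ∀ A : E × E → E →L[ℝ] E →L[ℝ] (E →L[ℝ] ℝ), ContDiffAt ℝ ∞ A z →
      ContDiffAt ℝ ∞ (fun z ↦ (A z).flip) z := fun A hA ↦
    ContDiffAt.comp z
      (ContinuousLinearMap.flipₗᵢ ℝ E E (E →L[ℝ] ℝ)).contDiff.contDiffAt hA
  have hflip' : ∀ A : E × E → E →L[ℝ] E →L[ℝ] ℝ, ContDiffAt ℝ ∞ A z →
      ContDiffAt ℝ ∞ (fun z ↦ (A z).flip) z := fun A hA ↦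
    ContDiffAt.comp z (ContinuousLinearMap.flipₗᵢ ℝ E E ℝ).contDiff.contDiffAt hA
  exact (((hflip' _ ((hflip _ h1).clm_apply hs)).clm_apply hs).const_smul (2⁻¹ : ℝ)).sub
    ((h1.clm_apply hs).clm_apply hs) |>.sub h2

theorem IsLocalRep.isInvertible [FiniteDimensional ℝ E] [IsManifold I ∞ M]
    (hG : IsLocalRep g x₀ G)
    (hnd : ∀ x (v : TangentSpace I x), (∀ w, g x v w = 0) → v = 0) {x : M}
    (hx : x ∈ (chartAt H x₀).source) : (G (extChartAt I x₀ x)).IsInvertible := by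
  set A := G (extChartAt I x₀ x) with hA
  have hinj : Function.Injective (A : E →ₗ[ℝ] E →L[ℝ] ℝ) := by
    rw [← LinearMap.ker_eq_bot, LinearMap.ker_eq_bot']
    intro a ha
    obtain ⟨v, rfl⟩ := (isInvertible_mvfderiv_extChartAt (I := I) hx).bijective.2 a
    rw [hnd x v fun w ↦ ?_, map_zero]
    rw [hG.eq x hx, ← hA]
    exact congrArg (fun l : E →L[ℝ] ℝ ↦ l _) ha
  have hfin : Module.finrank ℝ E = Module.finrank ℝ (E →L[ℝ] ℝ) := by
    rw [← LinearMap.toContinuousLinearMap.finrank_eq, Subspace.dual_finrank_eq]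
  exact ⟨(LinearEquiv.ofInjectiveOfFinrankEq (A : E →ₗ[ℝ] E →L[ℝ] ℝ) hinj
    hfin).toContinuousLinearEquiv, by ext; rfl⟩

variable [IsManifold I ∞ M] [I.Boundaryless]

theorem contDiffAt_comp_extChartAt_symm {h : M → ℝ} (hh : ContMDiff I 𝓘(ℝ, ℝ) ∞ h) {x : M}
    (hx : x ∈ (chartAt H x₀).source) :
    ContDiffAt ℝ ∞ (fun y ↦ h ((extChartAt I x₀).symm y)) (extChartAt I x₀ x) := by
  rw [← extChartAt_source I] at hx
  rw [← contMDiffAt_iff_contDiffAt]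
  refine ContMDiffAt.comp _ (hh _) ?_
  exact (contMDiffOn_extChartAt_symm x₀).contMDiffAt
    ((isOpen_extChartAt_target x₀).mem_nhds ((extChartAt I x₀).map_source hx))

theorem mvfderiv_eq_fderiv_comp_extChartAt_symm {h : M → ℝ} (hh : ContMDiff I 𝓘(ℝ, ℝ) ∞ h) {x : M}
    (hx : x ∈ (chartAt H x₀).source) (v : TangentSpace I x) :
    mvfderiv I h x v = fderiv ℝ (fun y ↦ h ((extChartAt I x₀).symm y)) (extChartAt I x₀ x)
      (mvfderiv I (extChartAt I x₀) x v) := by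
  rw [← mvfderiv_fderiv_comp
    ((contDiffAt_comp_extChartAt_symm hh hx).differentiableAt (by simp))
    (mdifferentiableAt_extChartAt hx)]
  have : h =ᶠ[𝓝 x] fun z ↦ h ((extChartAt I x₀).symm (extChartAt I x₀ z)) := by
    filter_upwards [extChartAt_source_mem_nhds' (I := I) (by rwa [extChartAt_source])] with z hz
    rw [(extChartAt I x₀).left_inv hz]
  rw [← mvfderiv_congr this]

variable [FiniteDimensional ℝ E]

/-- Newton's equation with potential `h`, in coordinates. -/
theorem eulerForm_eq_neg_mvfderiv_iff (hG : IsLocalRep g x₀ G)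
    (hsymm : ∀ x v w, g x v w = g x w v)
    (hnd : ∀ x (v : TangentSpace I x), (∀ w, g x v w = 0) → v = 0)
    {h : M → ℝ} (hh : ContMDiff I 𝓘(ℝ, ℝ) ∞ h)
    {p : TangentBundle I M} (hp : p.1 ∈ (chartAt H x₀).source)
    {d : TangentSpace I.tangent p} (hd : dProj p d = p.2) :
    (∀ ξ, eulerForm g p d ξ = -mvfderiv I h p.1 (dProj p ξ)) ↔
      (mvfderiv I.tangent (tangentCoord I x₀) p d).2 =
        (G (extChartAt I x₀ p.1)).inverse
          (accelerationForm G (fun y ↦ h ((extChartAt I x₀).symm y)) (tangentCoord I x₀ p)) := by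
  set a := (mvfderiv I.tangent (tangentCoord I x₀) p d).2 with ha
  set c := accelerationForm G (fun y ↦ h ((extChartAt I x₀).symm y)) (tangentCoord I x₀ p) with hc
  have hinv := hG.isInvertible hnd hp
  have h1 : a = (G (extChartAt I x₀ p.1)).inverse c ↔ G (extChartAt I x₀ p.1) a = c := by
    obtain ⟨e, he⟩ := hinv
    rw [← he, ContinuousLinearMap.inverse_equiv]
    exact e.toLinearEquiv.eq_symm_apply
  have key : ∀ ξ, eulerForm g p d ξ + mvfderiv I h p.1 (dProj p ξ)
      = G (extChartAt I x₀ p.1) a (mvfderiv I (extChartAt I x₀) p.1 (dProj p ξ))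
        - c (mvfderiv I (extChartAt I x₀) p.1 (dProj p ξ)) := by
    intro ξ
    rw [eulerForm_apply_eq hG hsymm hp hd, mvfderiv_eq_fderiv_comp_extChartAt_symm hh hp, ← ha, hc,
      accelerationForm]
    simp [tangentCoord]
    ring
  rw [h1]
  constructor
  · intro hξ
    ext w
    obtain ⟨v, rfl⟩ := (isInvertible_mvfderiv_extChartAt (I := I) hp).bijective.2 w
    obtain ⟨ξ, rfl⟩ := dProj_surjective p v
    have := key ξ
    rw [hξ] at this
    linarith
  · intro h2 ξ
    have := key ξ
    rw [h2] at this
    linarith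

/-- The second order differential equation defined by a pseudo-Riemannian metric and a potential. -/
theorem exists_isSODE_eulerForm_eq (hg : IsSmoothTensor g) (hsymm : ∀ x v w, g x v w = g x w v)
    (hnd : ∀ x (v : TangentSpace I x), (∀ w, g x v w = 0) → v = 0)
    {h : M → ℝ} (hh : ContMDiff I 𝓘(ℝ, ℝ) ∞ h) :
    ∃ D : VField I.tangent (TangentBundle I M), IsSODE D ∧
      ∀ p ξ, eulerForm g p (D p) ξ = -mvfderiv I h p.1 (dProj p ξ) := by
  have hex : ∀ p : TangentBundle I M, ∃ d : TangentSpace I.tangent p, dProj p d = p.2 ∧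
      ∀ ξ, eulerForm g p d ξ = -mvfderiv I h p.1 (dProj p ξ) := by
    intro p
    obtain ⟨G, hG⟩ := hg p.1
    have hp := mem_chart_source H p.1
    obtain ⟨d, hd⟩ := (isInvertible_mvfderiv_tangentCoord hp).bijective.2
      (mvfderiv I (extChartAt I p.1) p.1 p.2, (G (extChartAt I p.1 p.1)).inverse
          (accelerationForm G (fun y ↦ h ((extChartAt I p.1).symm y)) (tangentCoord I p.1 p)))
    have hd' : dProj p d = p.2 := by
      apply (isInvertible_mvfderiv_extChartAt (I := I) hp).bijective.1
      rw [← mvfderiv_tangentCoord_fst hp, hd]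
    refine ⟨d, hd', (eulerForm_eq_neg_mvfderiv_iff hG hsymm hnd hh hp hd').2 ?_⟩
    rw [hd]
  choose D hD hDe using hex
  refine ⟨D, ⟨fun p₀ ↦ ?_, hD⟩, hDe⟩
  obtain ⟨G, hG⟩ := hg p₀.1
  have hp₀ := mem_chart_source H p₀.1
  rw [Bundle.contMDiffAt_section]
  have hc : ContMDiffAt I.tangent 𝓘(ℝ, E × E) ∞ (tangentCoord I p₀.1) p₀ :=
    contMDiffAt_tangentCoord hp₀
  set Φ : E × E → E × E := fun z ↦ (z.2, (G z.1).inverse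
    (accelerationForm G (fun y ↦ h ((extChartAt I p₀.1).symm y)) z)) with hΦ
  have hsm : ContDiffAt ℝ ∞ Φ (tangentCoord I p₀.1 p₀) := by
    refine contDiffAt_snd.prodMk (ContDiffAt.clm_apply ?_ (contDiffAt_accelerationForm
      (hG.contDiffAt hp₀) (contDiffAt_comp_extChartAt_symm hh hp₀)))
    have : CompleteSpace E := FiniteDimensional.complete ℝ E
    exact ContDiffAt.comp (g := ContinuousLinearMap.inverse) (tangentCoord I p₀.1 p₀)
      (ContinuousLinearMap.IsInvertible.contDiffAt_map_inverse (hG.isInvertible hnd hp₀))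
      (ContDiffAt.comp (g := G) (f := Prod.fst) (tangentCoord I p₀.1 p₀)
        (hG.contDiffAt hp₀) contDiffAt_fst)
  refine (ContMDiffAt.comp p₀ hsm.contMDiffAt hc).congr_of_eventuallyEq ?_
  filter_upwards [mem_nhds_proj_source hp₀] with p hp
  have h1 : (trivializationAt (E × E) (TangentSpace I.tangent) p₀
      (⟨p, D p⟩ : TangentBundle I.tangent (TangentBundle I M))).2
      = mvfderiv I.tangent (extChartAt I.tangent p₀) p (D p) :=
    trivializationAt_snd_eq (I := I.tangent) (p := ⟨p, D p⟩)
      ((TangentBundle.mem_chart_source_iff p p₀).2 hp)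
  refine h1.trans ?_
  rw [← mvfderiv_congr (tangentCoord_eventuallyEq (q := p₀) hp)]
  refine Prod.ext ?_ ?_
  · rw [mvfderiv_tangentCoord_fst hp, hD]
    rfl
  · exact (eulerForm_eq_neg_mvfderiv_iff hG hsymm hnd hh hp (hD p)).1 (hDe p)

end NewtonFields

section Smoothness

open Filter Topology

variable {E : Type*} [NormedAddCommGroup E] [NormedSpace ℝ E]
  {H : Type*} [TopologicalSpace H] {I : ModelWithCorners ℝ E H}
  {M : Type*} [TopologicalSpace M] [ChartedSpace H M] [IsManifold I ∞ M]

/-- The inverse of the trivialization, at `x`, is the inverse of the differential of the chart. -/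
theorem mvfderiv_extChartAt_symmL {x₀ x : M} (hx : x ∈ (chartAt H x₀).source) (a : E) :
    mvfderiv I (extChartAt I x₀) x ((trivializationAt E (TangentSpace I) x₀).symmL ℝ x a) = a := by
  have hx' : x ∈ (trivializationAt E (TangentSpace I) x₀).baseSet := by simpa using hx
  rw [Bundle.Trivialization.symmL_apply _ hx']
  have h := trivializationAt_snd_eq (I := I)
    (p := ⟨x, (trivializationAt E (TangentSpace I) x₀).symm x a⟩) hx
  rw [← h]
  have := (trivializationAt E (TangentSpace I) x₀).apply_mk_symm hx' a
  exact congrArg Prod.snd this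

theorem contMDiffOn_trivializationAt_symmL (x₀ : M) (a : E) :
    ContMDiffOn I I.tangent ∞ (fun x ↦ (⟨x, (trivializationAt E (TangentSpace I) x₀).symmL ℝ x a⟩ :
      TangentBundle I M)) (chartAt H x₀).source := by
  set e := trivializationAt E (TangentSpace I) x₀
  have h1 : ContMDiffOn I (I.prod 𝓘(ℝ, E)) ∞ (fun x : M ↦ (x, a)) (chartAt H x₀).source :=
    (contMDiff_id.prodMk contMDiff_const).contMDiffOn
  have h2 := (e.contMDiffOn_symm (n := ∞) (IB := I)).comp h1 (fun x hx ↦ by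
    exact e.mk_mem_target.2 (by simpa [e] using hx))
  refine h2.congr fun x hx ↦ ?_
  have hx' : x ∈ e.baseSet := by simpa [e] using hx
  rw [Bundle.Trivialization.symmL_apply _ hx']
  exact e.mk_symm hx' a

theorem isSmoothTensor_of_contMDiff [FiniteDimensional ℝ E] [I.Boundaryless] {g : CovTensor2 I M}
    (hg : ContMDiff I (I.prod 𝓘(ℝ, E →L[ℝ] E →L[ℝ] ℝ)) ∞
      (fun x ↦ Bundle.TotalSpace.mk' (E →L[ℝ] E →L[ℝ] ℝ)
        (E := fun x : M ↦ TangentSpace I x →L[ℝ] TangentSpace I x →L[ℝ] ℝ) x (g x))) :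
    IsSmoothTensor g := by
  intro x₀
  set e := trivializationAt E (TangentSpace I) x₀ with he
  let S : M → E →L[ℝ] E := fun x ↦ e.symmL ℝ x
  let G : E → E →L[ℝ] E →L[ℝ] ℝ := fun y ↦
    (ContinuousLinearMap.precomp ℝ (S ((extChartAt I x₀).symm y))).comp
      ((g ((extChartAt I x₀).symm y) : E →L[ℝ] E →L[ℝ] ℝ).comp (S ((extChartAt I x₀).symm y)))
  have hGapply : ∀ y a b, G y a b = g ((extChartAt I x₀).symm y)
    (e.symmL ℝ ((extChartAt I x₀).symm y) a) (e.symmL ℝ ((extChartAt I x₀).symm y) b) :=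
    fun _ _ _ ↦ rfl
  refine ⟨G, ?_, ?_⟩
  · refine contDiffOn_clm_apply.2 fun a ↦ contDiffOn_clm_apply.2 fun b ↦ ?_
    have h1 : ContMDiffOn I 𝓘(ℝ, ℝ) ∞ (fun x ↦ g x (e.symmL ℝ x a) (e.symmL ℝ x b))
        (chartAt H x₀).source := by
      intro x hx
      have h2 : ContMDiffWithinAt I (I.prod 𝓘(ℝ)) ∞
          (fun m ↦ Bundle.TotalSpace.mk' ℝ (E := Bundle.Trivial M ℝ) m
            (g m (e.symmL ℝ m a) (e.symmL ℝ m b))) (chartAt H x₀).source x :=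
        ContMDiffWithinAt.clm_bundle_apply₂ (F₁ := E) (F₂ := E) (b := fun m ↦ m)
          (hg.contMDiffAt.contMDiffWithinAt)
          (contMDiffOn_trivializationAt_symmL x₀ a x hx)
          (contMDiffOn_trivializationAt_symmL x₀ b x hx)
      rw [Bundle.contMDiffWithinAt_totalSpace] at h2
      exact h2.2
    rw [← contMDiffOn_iff_contDiffOn]
    refine h1.comp (contMDiffOn_extChartAt_symm x₀) fun y hy ↦ ?_
    rw [← extChartAt_source I]
    exact (extChartAt I x₀).map_target hy
  · intro x hx v w
    have hl : (extChartAt I x₀).symm (extChartAt I x₀ x) = x :=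
      (extChartAt I x₀).left_inv (by rwa [extChartAt_source])
    have hinj := (isInvertible_mvfderiv_extChartAt (I := I) hx).bijective.1
    have hv : ∀ v : TangentSpace I x, e.symmL ℝ x (mvfderiv I (extChartAt I x₀) x v) = v := fun v ↦
      hinj (mvfderiv_extChartAt_symmL hx _)
    rw [hGapply, hl, hv, hv]

end Smoothness

section Diffeomorphisms

open Filter Topology

variable {E : Type*} [NormedAddCommGroup E] [NormedSpace ℝ E]
  {H : Type*} [TopologicalSpace H] {I : ModelWithCorners ℝ E H}
  {M : Type*} [TopologicalSpace M] [ChartedSpace H M]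
  {F : Type*} [NormedAddCommGroup F] [NormedSpace ℝ F]
  {K : Type*} [TopologicalSpace K] {J : ModelWithCorners ℝ F K}
  {R : Type*} [TopologicalSpace R] [ChartedSpace K R]

theorem tangentMap_symm_tangentMap (φ : R ≃ₘ⟮J, I⟯ M) (p : TangentBundle J R) :
    tangentMap I J φ.symm (tangentMap J I φ p) = p := by
  have h := tangentMap_comp_at p (φ.symm.contMDiff.mdifferentiable (by simp) (φ p.1))
    (φ.contMDiff.mdifferentiable (by simp) p.1)
  rw [← h]
  have h2 : φ.symm ∘ φ = id := funext φ.symm_apply_apply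
  rw [h2, tangentMap_id]
  rfl

theorem mfderiv_diffeomorph_bijective (φ : R ≃ₘ⟮J, I⟯ M) (x : R) :
    Function.Bijective (mfderiv J I φ x) :=
  (φ.mfderivToContinuousLinearEquiv (by simp) x).bijective

variable [IsManifold I ∞ M] [IsManifold J ∞ R]

/-- The action of a diffeomorphism on the tangent bundles. -/
def tangentDiffeomorph (φ : R ≃ₘ⟮J, I⟯ M) :
    TangentBundle J R ≃ₘ⟮J.tangent, I.tangent⟯ TangentBundle I M where
  toFun := tangentMap J I φ
  invFun := tangentMap I J φ.symm
  left_inv := tangentMap_symm_tangentMap φ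
  right_inv := tangentMap_symm_tangentMap φ.symm
  contMDiff_toFun := φ.contMDiff.contMDiff_tangentMap (by simp)
  contMDiff_invFun := φ.symm.contMDiff.contMDiff_tangentMap (by simp)

theorem mfderiv_tangentMap_bijective (φ : R ≃ₘ⟮J, I⟯ M) (p : TangentBundle J R) :
    Function.Bijective (mfderiv J.tangent I.tangent (tangentMap J I φ) p) :=
  mfderiv_diffeomorph_bijective (tangentDiffeomorph φ) p

theorem exists_isPushforward (φ : R ≃ₘ⟮J, I⟯ M) (D : VField I.tangent (TangentBundle I M)) :
    ∃ D₁, IsPushforward φ D₁ D :=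
  ⟨_, fun p ↦ ((mfderiv_tangentMap_bijective φ p).2 _).choose_spec⟩

theorem IsPushforward.dProj_eq {φ : R ≃ₘ⟮J, I⟯ M} {D₁ D} (h : IsPushforward φ D₁ D)
    (hD : IsSODE D) (p : TangentBundle J R) : dProj p (D₁ p) = p.2 := by
  apply (mfderiv_diffeomorph_bijective φ p.1).1
  rw [← dProj_mfderiv_tangentMap φ.contMDiff, h p, hD.proj]
  rfl

theorem exists_sub_eq_verticalLift {p : TangentBundle I M} {d e : TangentSpace I.tangent p}
    (h : dProj p d = dProj p e) : ∃ Y, d - e = verticalLift p Y :=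
  exists_verticalLift_eq (by rw [map_sub, h, sub_self])

theorem exists_contMDiff_mvfderiv_eq [FiniteDimensional ℝ E] [T2Space M] (x : M)
    (l : TangentSpace I x →L[ℝ] ℝ) :
    ∃ h : M → ℝ, ContMDiff I 𝓘(ℝ, ℝ) ∞ h ∧ mvfderiv I h x = l := by
  obtain ⟨e, he⟩ := isInvertible_mvfderiv_extChartAt (I := I) (mem_chart_source H x)
  let L : E →L[ℝ] ℝ := l.comp (e.symm : E →L[ℝ] TangentSpace I x)
  obtain ⟨f⟩ : Nonempty (SmoothBumpFunction I x) := inferInstance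
  refine ⟨fun z ↦ f z • L (extChartAt I x z), f.contMDiff_smul ?_, ?_⟩
  · exact L.contDiff.contMDiff.comp_contMDiffOn contMDiffOn_extChartAt
  · have h1 : (fun z ↦ f z • L (extChartAt I x z)) =ᶠ[𝓝 x] fun z ↦ L (extChartAt I x z) := by
      filter_upwards [f.eventuallyEq_one] with z hz
      rw [hz, Pi.one_apply, one_smul]
    rw [mvfderiv_congr h1]
    ext v
    rw [mvfderiv_fderiv_comp L.differentiableAt (mdifferentiableAt_extChartAt
      (mem_chart_source H x)), L.fderiv, ← he]
    exact congrArg l (e.symm_apply_apply v)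

end Diffeomorphisms

section ProductMetric

open Filter Topology

variable {E : Type*} [NormedAddCommGroup E] [NormedSpace ℝ E]
  {H : Type*} [TopologicalSpace H] {I : ModelWithCorners ℝ E H}
  {M : Type*} [TopologicalSpace M] [ChartedSpace H M]

variable (I) in
/-- The differential of the projection `ℝ × M → M`. -/
def dSnd (p : ℝ × M) : TangentSpace (𝓘(ℝ, ℝ).prod I) p →L[ℝ] TangentSpace I p.2 :=
  mfderiv (𝓘(ℝ, ℝ).prod I) I (fun q : ℝ × M ↦ q.2) p

variable (I) in
/-- The vector tangent to `ℝ × M` with given components. -/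
def tangentPair (p : ℝ × M) (s : ℝ) (u : TangentSpace I p.2) :
    TangentSpace (𝓘(ℝ, ℝ).prod I) p := ((s, u) : ℝ × E)

theorem dt_apply (p : ℝ × M) (v : TangentSpace (𝓘(ℝ, ℝ).prod I) p) :
    dt I M p v = (v : ℝ × E).1 :=
  congrArg (fun A ↦ A v) (mfderiv_fst (I := 𝓘(ℝ, ℝ)) (I' := I) (x := p))

theorem dSnd_apply (p : ℝ × M) (v : TangentSpace (𝓘(ℝ, ℝ).prod I) p) :
    dSnd I p v = (v : ℝ × E).2 :=
  congrArg (fun A ↦ A v) (mfderiv_snd (I := 𝓘(ℝ, ℝ)) (I' := I) (x := p))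

@[simp]
theorem dt_tangentPair (p : ℝ × M) (s : ℝ) (u : TangentSpace I p.2) :
    dt I M p (tangentPair I p s u) = s := dt_apply p _

@[simp]
theorem dSnd_tangentPair (p : ℝ × M) (s : ℝ) (u : TangentSpace I p.2) :
    dSnd I p (tangentPair I p s u) = u := dSnd_apply p _

theorem tangentSpace_prod_ext {p : ℝ × M} {v w : TangentSpace (𝓘(ℝ, ℝ).prod I) p}
    (h1 : dt I M p v = dt I M p w) (h2 : dSnd I p v = dSnd I p w) : v = w := by
  rw [dt_apply, dt_apply] at h1
  rw [dSnd_apply, dSnd_apply] at h2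
  exact Prod.ext h1 h2

theorem productMetric_apply (g : CovTensor2 I M) (p : ℝ × M)
    (v w : TangentSpace (𝓘(ℝ, ℝ).prod I) p) :
    productMetric g p v w = dt I M p v * dt I M p w + g p.2 (dSnd I p v) (dSnd I p w) := rfl

theorem productMetric_symm {g : CovTensor2 I M} (hg : ∀ x v w, g x v w = g x w v) (x : ℝ × M)
    (v w : TangentSpace (𝓘(ℝ, ℝ).prod I) x) :
    productMetric g x v w = productMetric g x w v := by
  rw [productMetric_apply, productMetric_apply, hg, mul_comm]

theorem productMetric_nondegenerate {g : CovTensor2 I M}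
    (hg : ∀ x (v : TangentSpace I x), (∀ w, g x v w = 0) → v = 0) (x : ℝ × M)
    (v : TangentSpace (𝓘(ℝ, ℝ).prod I) x) (h : ∀ w, productMetric g x v w = 0) : v = 0 := by
  refine tangentSpace_prod_ext ?_ ((hg x.2 _ fun w ↦ ?_).trans (map_zero _).symm)
  · have := h (tangentPair I x 1 0)
    rw [productMetric_apply, dt_tangentPair, dSnd_tangentPair, map_zero, mul_one, add_zero] at this
    rw [this, map_zero]
  · have := h (tangentPair I x 0 w)
    rwa [productMetric_apply, dt_tangentPair, dSnd_tangentPair, mul_zero, zero_add] at this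

/-- The insertion of bilinear forms on `E` in bilinear forms on `ℝ × E`. -/
def bilinExtend : (E →L[ℝ] E →L[ℝ] ℝ) →L[ℝ] (ℝ × E →L[ℝ] ℝ × E →L[ℝ] ℝ) :=
  (ContinuousLinearMap.postcomp (ℝ × E)
    (ContinuousLinearMap.precomp ℝ (ContinuousLinearMap.snd ℝ ℝ E))).comp
    (ContinuousLinearMap.precomp (E →L[ℝ] ℝ) (ContinuousLinearMap.snd ℝ ℝ E))

/-- The expression in coordinates of the product metric. -/
def productRep (G : E → E →L[ℝ] E →L[ℝ] ℝ) (z : ℝ × E) : ℝ × E →L[ℝ] ℝ × E →L[ℝ] ℝ :=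
  (ContinuousLinearMap.fst ℝ ℝ E).smulRight (ContinuousLinearMap.fst ℝ ℝ E) + bilinExtend (G z.2)

theorem productRep_apply (G : E → E →L[ℝ] E →L[ℝ] ℝ) (z v w : ℝ × E) :
    productRep G z v w = v.1 * w.1 + G z.2 v.2 w.2 := rfl

set_option maxSynthPendingDepth 3 in
theorem fderiv_productRep_apply {G : E → E →L[ℝ] E →L[ℝ] ℝ} {z : ℝ × E}
    (hG : DifferentiableAt ℝ G z.2) (a v w : ℝ × E) :
    fderiv ℝ (productRep G) z a v w = fderiv ℝ G z.2 a.2 v.2 w.2 := by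
  have h1 : HasFDerivAt (fun z : ℝ × E ↦ G z.2)
      ((fderiv ℝ G z.2).comp (ContinuousLinearMap.snd ℝ ℝ E)) z :=
    HasFDerivAt.comp (g := G) z hG.hasFDerivAt
      (hasFDerivAt_snd (𝕜 := ℝ) (E := ℝ) (F := E) (p := z))
  have h2 : HasFDerivAt (productRep G)
      (bilinExtend.comp ((fderiv ℝ G z.2).comp (ContinuousLinearMap.snd ℝ ℝ E))) z :=
    (HasFDerivAt.comp (g := bilinExtend (E := E)) z
      (bilinExtend (E := E)).hasFDerivAt h1).const_add _
  rw [h2.fderiv]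
  rfl

theorem mem_chart_source_prod_iff {x₀ x : ℝ × M} :
    x ∈ (chartAt (ModelProd ℝ H) x₀).source ↔ x.2 ∈ (chartAt H x₀.2).source := by
  simp [prodChartedSpace_chartAt, chartAt_self_eq]

variable [IsManifold I ∞ M]

theorem mvfderiv_extChartAt_prod {x₀ x : ℝ × M} (hx : x.2 ∈ (chartAt H x₀.2).source)
    (v : TangentSpace (𝓘(ℝ, ℝ).prod I) x) :
    mvfderiv (𝓘(ℝ, ℝ).prod I) (extChartAt (𝓘(ℝ, ℝ).prod I) x₀) x v
      = (dt I M x v, mvfderiv I (extChartAt I x₀.2) x.2 (dSnd I x v)) := by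
  have hx' : x ∈ (chartAt (ModelProd ℝ H) x₀).source := by
    rw [mem_chart_source_prod_iff]
    exact hx
  have hd := mdifferentiableAt_extChartAt (I := 𝓘(ℝ, ℝ).prod I) hx'
  refine Prod.ext ?_ ?_
  · have h1 := mvfderiv_fderiv_comp (g := (Prod.fst : ℝ × E → ℝ)) differentiableAt_fst hd v
    rw [fderiv_fst] at h1
    exact h1.symm
  · have h1 := mvfderiv_fderiv_comp (g := (Prod.snd : ℝ × E → E)) differentiableAt_snd hd v
    rw [fderiv_snd] at h1
    exact h1.symm.trans (mvfderiv_comp_mfderiv (f := fun q : ℝ × M ↦ q.2)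
      (mdifferentiableAt_extChartAt (I := I) hx) mdifferentiableAt_snd v)

set_option maxSynthPendingDepth 3 in
theorem isLocalRep_productMetric {g : CovTensor2 I M} {x₀ : ℝ × M}
    {G : E → E →L[ℝ] E →L[ℝ] ℝ} (hG : IsLocalRep g x₀.2 G) :
    IsLocalRep (productMetric g) x₀ (productRep G) := by
  refine ⟨?_, fun x hx v w ↦ ?_⟩
  · refine contDiffOn_const.add (ContDiff.comp_contDiffOn (f := fun z : ℝ × E ↦ G z.2)
      (bilinExtend (E := E)).contDiff
      (hG.contDiffOn.comp (f := Prod.snd) contDiffOn_snd fun z hz ↦ ?_))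
    rw [extChartAt_prod] at hz
    exact hz.2
  · have hx' : x.2 ∈ (chartAt H x₀.2).source := mem_chart_source_prod_iff.1 hx
    rw [productMetric_apply, mvfderiv_extChartAt_prod hx', mvfderiv_extChartAt_prod hx',
      productRep_apply, hG.eq _ hx', extChartAt_prod]
    rfl

theorem IsSmoothTensor.productMetric {g : CovTensor2 I M} (hg : IsSmoothTensor g) :
    IsSmoothTensor (productMetric g) := fun x₀ ↦
  ⟨_, isLocalRep_productMetric (hg x₀.2).choose_spec⟩

theorem dotFun_dt_eq {x₀ : ℝ × M} {p : TangentBundle (𝓘(ℝ, ℝ).prod I) (ℝ × M)}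
    (hp : p.1 ∈ (chartAt (ModelProd ℝ H) x₀).source) :
    dotFun (dt I M) p = (tangentCoord (𝓘(ℝ, ℝ).prod I) x₀ p).2.1 := by
  have hp' : p.1.2 ∈ (chartAt H x₀.2).source := mem_chart_source_prod_iff.1 hp
  rw [tangentCoord, mvfderiv_extChartAt_prod hp']
  rfl

variable (E) in
theorem hasFDerivAt_snd_fst (z : (ℝ × E) × (ℝ × E)) :
    HasFDerivAt (fun z : (ℝ × E) × (ℝ × E) ↦ z.2.1)
      ((ContinuousLinearMap.fst ℝ ℝ E).comp (ContinuousLinearMap.snd ℝ (ℝ × E) (ℝ × E))) z :=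
  ((ContinuousLinearMap.fst ℝ ℝ E).comp
    (ContinuousLinearMap.snd ℝ (ℝ × E) (ℝ × E))).hasFDerivAt

theorem dotFun_dt_eventuallyEq {x₀ : ℝ × M} {p : TangentBundle (𝓘(ℝ, ℝ).prod I) (ℝ × M)}
    (hp : p.1 ∈ (chartAt (ModelProd ℝ H) x₀).source) :
    dotFun (dt I M) =ᶠ[𝓝 p] fun q ↦ (tangentCoord (𝓘(ℝ, ℝ).prod I) x₀ q).2.1 := by
  filter_upwards [mem_nhds_proj_source hp] with q hq using dotFun_dt_eq hq

theorem mdifferentiableAt_dotFun_dt (p : TangentBundle (𝓘(ℝ, ℝ).prod I) (ℝ × M)) :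
    MDifferentiableAt (𝓘(ℝ, ℝ).prod I).tangent 𝓘(ℝ, ℝ) (dotFun (dt I M)) p := by
  have hp := mem_chart_source (ModelProd ℝ H) p.1
  exact (MDifferentiableAt.comp (g := fun z : (ℝ × E) × (ℝ × E) ↦ z.2.1)
    (f := tangentCoord (𝓘(ℝ, ℝ).prod I) p.1) p
    (hasFDerivAt_snd_fst E _).differentiableAt.mdifferentiableAt
    (mdifferentiableAt_tangentCoord hp)).congr_of_eventuallyEq (dotFun_dt_eventuallyEq hp)

theorem diffFun_dotFun_dt_apply (p : TangentBundle (𝓘(ℝ, ℝ).prod I) (ℝ × M))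
    (d : TangentSpace (𝓘(ℝ, ℝ).prod I).tangent p) :
    diffFun (dotFun (dt I M)) p d
      = (mvfderiv (𝓘(ℝ, ℝ).prod I).tangent (tangentCoord (𝓘(ℝ, ℝ).prod I) p.1) p d).2.1 := by
  have hp := mem_chart_source (ModelProd ℝ H) p.1
  have h1 := mvfderiv_fderiv_comp (hasFDerivAt_snd_fst E _).differentiableAt
    (mdifferentiableAt_tangentCoord hp) d
  rw [← mvfderiv_congr (dotFun_dt_eventuallyEq hp), (hasFDerivAt_snd_fst E _).fderiv] at h1
  exact h1

theorem diffFun_dotFun_dt_verticalLift (p : TangentBundle (𝓘(ℝ, ℝ).prod I) (ℝ × M))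
    (Y : TangentSpace (𝓘(ℝ, ℝ).prod I) p.1) :
    diffFun (dotFun (dt I M)) p (verticalLift p Y) = dt I M p.1 Y := by
  rw [diffFun_dotFun_dt_apply, mvfderiv_tangentCoord_verticalLift
    (mem_chart_source (ModelProd ℝ H) p.1), mvfderiv_extChartAt_prod (mem_chart_source H p.1.2)]

/-- The component along `∂/∂t` of the equations of motion for the product metric. -/
theorem eulerForm_productMetric_apply [I.Boundaryless] {g : CovTensor2 I M}
    (hg : IsSmoothTensor g)
    (hsymm : ∀ x v w, g x v w = g x w v) {p : TangentBundle (𝓘(ℝ, ℝ).prod I) (ℝ × M)}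
    {d ξ : TangentSpace (𝓘(ℝ, ℝ).prod I).tangent p} (hd : dProj p d = p.2)
    (hξ : dProj p ξ = tangentPair I p.1 1 0) :
    eulerForm (productMetric g) p d ξ = diffFun (dotFun (dt I M)) p d := by
  obtain ⟨G, hG⟩ := hg p.1.2
  have hp := mem_chart_source (ModelProd ℝ H) p.1
  have hp2 := mem_chart_source H p.1.2
  have hGd : DifferentiableAt ℝ G (extChartAt (𝓘(ℝ, ℝ).prod I) p.1 p.1).2 := by
    rw [extChartAt_prod]
    exact hG.differentiableAt hp2
  have h1 : mvfderiv (𝓘(ℝ, ℝ).prod I) (extChartAt (𝓘(ℝ, ℝ).prod I) p.1) p.1 (dProj p ξ)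
      = ((1, 0) : ℝ × E) := by
    rw [mvfderiv_extChartAt_prod hp2, hξ, dt_tangentPair, dSnd_tangentPair, map_zero]
  rw [eulerForm_apply_eq (isLocalRep_productMetric hG) (productMetric_symm hsymm) hp hd, h1,
    fderiv_productRep_apply hGd, fderiv_productRep_apply hGd, productRep_apply,
    diffFun_dotFun_dt_apply]
  simp

end ProductMetric

section Frame

open Filter Topology

variable {E : Type*} [NormedAddCommGroup E] [NormedSpace ℝ E]
  {H : Type*} [TopologicalSpace H] {I : ModelWithCorners ℝ E H}
  {M : Type*} [TopologicalSpace M] [ChartedSpace H M]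

theorem dt_mfderiv_frame (φ : OneParameterGroup I M) (x : ℝ × M)
    (v : TangentSpace (𝓘(ℝ, ℝ).prod I) x) :
    dt I M (φ.frame x) (mfderiv (𝓘(ℝ, ℝ).prod I) (𝓘(ℝ, ℝ).prod I) φ.frame x v) = dt I M x v := by
  have h := mfderiv_comp (I'' := 𝓘(ℝ, ℝ)) (g := fun q : ℝ × M ↦ q.1) x mdifferentiableAt_fst
    (φ.frame.contMDiff.mdifferentiable (by simp) x)
  exact (congrArg (fun A ↦ A v) h).symm

theorem mfderiv_frame_tangentPair (φ : OneParameterGroup I M) (x : ℝ × M)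
    (u : TangentSpace I x.2) :
    mfderiv (𝓘(ℝ, ℝ).prod I) (𝓘(ℝ, ℝ).prod I) φ.frame x (tangentPair I x 0 u)
      = tangentPair I (φ.frame x) 0 (mfderiv I I (φ.map x.1) x.2 u) := by
  have hφ : MDifferentiableAt I I (φ.map x.1) x.2 :=
    (φ.contMDiff.comp (contMDiff_const.prodMk contMDiff_id)).mdifferentiable (by simp) x.2
  have h1 := mfderiv_comp (f := fun y ↦ (x.1, y)) x.2
    (φ.frame.contMDiff.mdifferentiable (by simp) x)
    (mdifferentiableAt_const.prodMk mdifferentiableAt_id)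
  have h2 := mfderiv_comp (f := φ.map x.1) (g := fun y ↦ (x.1, y)) (I := I) (I' := I)
    (I'' := 𝓘(ℝ, ℝ).prod I) x.2 (mdifferentiableAt_const.prodMk mdifferentiableAt_id) hφ
  rw [mfderiv_prod_right] at h1 h2
  exact congrArg (fun A ↦ A u) (h1.symm.trans h2)

variable [IsManifold I ∞ M]

theorem diffFun_dotFun_dt_tangentMap_frame (φ : OneParameterGroup I M)
    (p : TangentBundle (𝓘(ℝ, ℝ).prod I) (ℝ × M)) (d : TangentSpace (𝓘(ℝ, ℝ).prod I).tangent p) :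
    diffFun (dotFun (dt I M)) (tangentMap (𝓘(ℝ, ℝ).prod I) (𝓘(ℝ, ℝ).prod I) φ.frame p)
        (mfderiv (𝓘(ℝ, ℝ).prod I).tangent (𝓘(ℝ, ℝ).prod I).tangent
          (tangentMap (𝓘(ℝ, ℝ).prod I) (𝓘(ℝ, ℝ).prod I) φ.frame) p d)
      = diffFun (dotFun (dt I M)) p d := by
  have h := mfderiv_comp p (mdifferentiableAt_dotFun_dt (I := I)
    (tangentMap (𝓘(ℝ, ℝ).prod I) (𝓘(ℝ, ℝ).prod I) φ.frame p))
    (mdifferentiable_tangentMap φ.frame.contMDiff p)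
  have h2 : dotFun (dt I M) ∘ tangentMap (𝓘(ℝ, ℝ).prod I) (𝓘(ℝ, ℝ).prod I) φ.frame
      = dotFun (dt I M) := funext fun q ↦ dt_mfderiv_frame φ q.1 q.2
  rw [h2] at h
  exact (congrArg (fun A ↦ A d) h).symm

theorem dSnd_dProj_tangentMap_frame (φ : OneParameterGroup I M)
    (p : TangentBundle (𝓘(ℝ, ℝ).prod I) (ℝ × M)) {ξ : TangentSpace (𝓘(ℝ, ℝ).prod I).tangent p}
    {w : TangentSpace I p.1.2} (hξ : dProj p ξ = tangentPair I p.1 0 w) :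
    dSnd I (φ.frame p.1) (dProj (tangentMap (𝓘(ℝ, ℝ).prod I) (𝓘(ℝ, ℝ).prod I) φ.frame p)
      (mfderiv (𝓘(ℝ, ℝ).prod I).tangent (𝓘(ℝ, ℝ).prod I).tangent
        (tangentMap (𝓘(ℝ, ℝ).prod I) (𝓘(ℝ, ℝ).prod I) φ.frame) p ξ))
      = mfderiv I I (φ.map p.1.1) p.1.2 w := by
  rw [dProj_mfderiv_tangentMap φ.frame.contMDiff, hξ, mfderiv_frame_tangentPair]
  exact dSnd_tangentPair (φ.frame p.1) 0 _

variable [I.Boundaryless]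

/-- The equations of motion in terms of `eulerForm`. -/
theorem preservesEquationsOfMotion_iff (φ : OneParameterGroup I M)
    (g : CovTensor2 (𝓘(ℝ, ℝ).prod I) (ℝ × M)) :
    PreservesEquationsOfMotion φ.frame g (dt I M) g (dt I M) ↔
      ∀ D : VField (𝓘(ℝ, ℝ).prod I).tangent (TangentBundle (𝓘(ℝ, ℝ).prod I) (ℝ × M)), IsSODE D →
      (∀ p, diffFun (dotFun (dt I M)) p (D p) = 0) →
      ∀ D₁, IsPushforward φ.frame D₁ D → ∀ p, ∃ c : ℝ, ∀ ξ,
        eulerForm g p (D₁ p) ξ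
          - eulerForm g (tangentMap (𝓘(ℝ, ℝ).prod I) (𝓘(ℝ, ℝ).prod I) φ.frame p)
            (D (tangentMap (𝓘(ℝ, ℝ).prod I) (𝓘(ℝ, ℝ).prod I) φ.frame p))
            (mfderiv (𝓘(ℝ, ℝ).prod I).tangent (𝓘(ℝ, ℝ).prod I).tangent
              (tangentMap (𝓘(ℝ, ℝ).prod I) (𝓘(ℝ, ℝ).prod I) φ.frame) p ξ)
          = c * dt I M p.1 (dProj p ξ) := by
  have h0 : pullbackForm (𝓘(ℝ, ℝ).prod I) (𝓘(ℝ, ℝ).prod I) φ.frame (dt I M) = dt I M :=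
    funext fun x ↦ ContinuousLinearMap.ext fun v ↦ dt_mfderiv_frame φ x v
  refine (and_iff_right h0).trans ?_
  refine forall_congr' fun D ↦ forall_congr' fun _ ↦ forall_congr' fun _ ↦ forall_congr' fun D₁ ↦
    forall_congr' fun _ ↦ forall_congr' fun p ↦ exists_congr fun c ↦ ?_
  rw [ContinuousLinearMap.ext_iff]
  refine forall_congr' fun ξ ↦ ?_
  rw [sub_eq_add_neg]
  rfl

theorem contractExtDeriv_verticalLift_tangentPair {g : CovTensor2 I M} (hg : IsSmoothTensor g)
    (p : TangentBundle (𝓘(ℝ, ℝ).prod I) (ℝ × M)) (u : TangentSpace I p.1.2)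
    (ξ : TangentSpace (𝓘(ℝ, ℝ).prod I).tangent p) :
    contractExtDeriv (liouvilleForm (productMetric g)) p
      (verticalLift p (tangentPair I p.1 0 u)) ξ = g p.1.2 u (dSnd I p.1 (dProj p ξ)) := by
  rw [contractExtDeriv_verticalLift hg.productMetric, productMetric_apply, dt_tangentPair,
    dSnd_tangentPair, zero_mul, zero_add]

theorem preserves_of_isInertial {g : CovTensor2 I M} (hg : IsSmoothTensor g)
    (hsymm : ∀ x v w, g x v w = g x w v) (φ : OneParameterGroup I M)
    (h : IsInertial φ.frame (productMetric g) (productMetric g))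
    (hiso : ∀ t, pullbackTensor I I (φ.map t) g = g) :
    PreservesEquationsOfMotion φ.frame (productMetric g) (dt I M) (productMetric g)
      (dt I M) := by
  rw [preservesEquationsOfMotion_iff]
  intro D hD hDt D₁ hD₁ p
  have hG := hg.productMetric
  obtain ⟨Z, Z', ⟨hZ, hZe⟩, ⟨_, hZe'⟩, hZZ⟩ := h
  replace hZZ : Z' = Z := funext fun r ↦ (sub_eq_zero.1 (hZZ r).symm).symm
  subst hZZ
  have hZt : diffFun (dotFun (dt I M)) p (Z' p) = 0 := by
    obtain ⟨ξ, hξ⟩ := dProj_surjective p (tangentPair I p.1 1 0)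
    rw [← eulerForm_productMetric_apply hg hsymm (hZ.proj p) hξ]
    exact congrArg (fun A ↦ A ξ) (hZe' p)
  set q := tangentMap (𝓘(ℝ, ℝ).prod I) (𝓘(ℝ, ℝ).prod I) φ.frame p with hq
  obtain ⟨Y, hY⟩ := exists_sub_eq_verticalLift ((hD₁.dProj_eq hD p).trans (hZ.proj p).symm)
  have hYt : dt I M p.1 Y = 0 := by
    rw [← diffFun_dotFun_dt_verticalLift, ← hY, map_sub, hZt,
      ← diffFun_dotFun_dt_tangentMap_frame φ, hD₁ p, hDt, sub_zero]
  obtain ⟨u, rfl⟩ : ∃ u, Y = tangentPair I p.1 0 u :=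
    ⟨dSnd I p.1 Y, tangentSpace_prod_ext (by rw [hYt, dt_tangentPair])
      (dSnd_tangentPair _ _ _).symm⟩
  have e1 : ∀ ξ, eulerForm (productMetric g) p (D₁ p) ξ = g p.1.2 u (dSnd I p.1 (dProj p ξ)) := by
    intro ξ
    have h0 : eulerForm (productMetric g) p (Z' p) = 0 := hZe' p
    rw [← contractExtDeriv_verticalLift_tangentPair hg, ← hY, ← eulerForm_sub, h0, sub_zero]
  let U : TangentSpace I q.1.2 := mfderiv I I (φ.map p.1.1) p.1.2 u
  have e2 : ∀ ξ, eulerForm (productMetric g) q (D q)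
      (mfderiv (𝓘(ℝ, ℝ).prod I).tangent (𝓘(ℝ, ℝ).prod I).tangent
        (tangentMap (𝓘(ℝ, ℝ).prod I) (𝓘(ℝ, ℝ).prod I) φ.frame) p ξ)
      = g q.1.2 U (dSnd I q.1 (dProj q (mfderiv (𝓘(ℝ, ℝ).prod I).tangent (𝓘(ℝ, ℝ).prod I).tangent
        (tangentMap (𝓘(ℝ, ℝ).prod I) (𝓘(ℝ, ℝ).prod I) φ.frame) p ξ))) := by
    intro ξ
    have h0 : eulerForm (pullbackTensor (𝓘(ℝ, ℝ).prod I) (𝓘(ℝ, ℝ).prod I) φ.frame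
        (productMetric g)) p (Z' p) = 0 := hZe p
    have h1 := eulerForm_pullback hG φ.frame.contMDiff p (Z' p) ξ
    rw [h0, zero_apply] at h1
    have h2 := congrArg (mfderiv (𝓘(ℝ, ℝ).prod I).tangent (𝓘(ℝ, ℝ).prod I).tangent
        (tangentMap (𝓘(ℝ, ℝ).prod I) (𝓘(ℝ, ℝ).prod I) φ.frame) p) hY
    rw [map_sub, hD₁ p, mfderiv_tangentMap_verticalLift φ.frame.contMDiff,
      mfderiv_frame_tangentPair] at h2
    rw [← contractExtDeriv_verticalLift_tangentPair hg]
    refine Eq.trans ?_ (congrArg (fun d ↦ contractExtDeriv (liouvilleForm (productMetric g)) q d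
      (mfderiv (𝓘(ℝ, ℝ).prod I).tangent (𝓘(ℝ, ℝ).prod I).tangent
        (tangentMap (𝓘(ℝ, ℝ).prod I) (𝓘(ℝ, ℝ).prod I) φ.frame) p ξ)) h2)
    rw [← eulerForm_sub, sub_apply, ← h1, sub_zero]
  obtain ⟨T, hT⟩ := dProj_surjective p (tangentPair I p.1 1 0)
  set A : TangentSpace (𝓘(ℝ, ℝ).prod I).tangent p →L[ℝ] ℝ := eulerForm (productMetric g) p (D₁ p)
    - (eulerForm (productMetric g) q (D q)).comp
      (mfderiv (𝓘(ℝ, ℝ).prod I).tangent (𝓘(ℝ, ℝ).prod I).tangent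
        (tangentMap (𝓘(ℝ, ℝ).prod I) (𝓘(ℝ, ℝ).prod I) φ.frame) p) with hA
  have hAapply : ∀ ξ, A ξ = eulerForm (productMetric g) p (D₁ p) ξ
    - eulerForm (productMetric g) q (D q)
      (mfderiv (𝓘(ℝ, ℝ).prod I).tangent (𝓘(ℝ, ℝ).prod I).tangent
        (tangentMap (𝓘(ℝ, ℝ).prod I) (𝓘(ℝ, ℝ).prod I) φ.frame) p ξ) := fun _ ↦ rfl
  have hker : ∀ ξ, dt I M p.1 (dProj p ξ) = 0 → A ξ = 0 := by
    intro ξ hξ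
    obtain ⟨w, hw⟩ : ∃ w, dProj p ξ = tangentPair I p.1 0 w :=
      ⟨dSnd I p.1 (dProj p ξ), tangentSpace_prod_ext (by rw [hξ, dt_tangentPair])
        (dSnd_tangentPair _ _ _).symm⟩
    rw [hAapply, e1, hw, dSnd_tangentPair, e2, sub_eq_zero]
    refine Eq.trans ?_ (congrArg (g q.1.2 U) (dSnd_dProj_tangentMap_frame φ p hw)).symm
    exact (congrArg (fun S : CovTensor2 I M ↦ S p.1.2 u w) (hiso p.1.1)).symm
  refine ⟨A T, fun ξ ↦ ?_⟩
  rw [← hAapply]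
  have h1 := hker (ξ - dt I M p.1 (dProj p ξ) • T) (by
    rw [map_sub, map_smul, hT, map_sub, map_smul, dt_tangentPair, smul_eq_mul, mul_one, sub_self])
  rw [map_sub, map_smul, smul_eq_mul, sub_eq_zero] at h1
  rw [h1, mul_comm]

variable [FiniteDimensional ℝ E]

/-- The equations of motion for the product metric and a potential that does not depend on time. -/
theorem exists_isSODE_productMetric {g : CovTensor2 I M} (hg : IsSmoothTensor g)
    (hsymm : ∀ x v w, g x v w = g x w v)
    (hnd : ∀ x (v : TangentSpace I x), (∀ w, g x v w = 0) → v = 0)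
    {k : M → ℝ} (hk : ContMDiff I 𝓘(ℝ, ℝ) ∞ k) :
    ∃ D : VField (𝓘(ℝ, ℝ).prod I).tangent (TangentBundle (𝓘(ℝ, ℝ).prod I) (ℝ × M)), IsSODE D ∧
      (∀ p, diffFun (dotFun (dt I M)) p (D p) = 0) ∧
      ∀ p ξ, eulerForm (productMetric g) p (D p) ξ
        = -mvfderiv I k p.1.2 (dSnd I p.1 (dProj p ξ)) := by
  have hk' : ContMDiff (𝓘(ℝ, ℝ).prod I) 𝓘(ℝ, ℝ) ∞ (fun z : ℝ × M ↦ k z.2) :=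
    hk.comp contMDiff_snd
  obtain ⟨D, hD, hDe⟩ := exists_isSODE_eulerForm_eq hg.productMetric (productMetric_symm hsymm)
    (productMetric_nondegenerate hnd) hk'
  have hDe' : ∀ p ξ, eulerForm (productMetric g) p (D p) ξ
      = -mvfderiv I k p.1.2 (dSnd I p.1 (dProj p ξ)) := fun p ξ ↦ (hDe p ξ).trans
    (congrArg Neg.neg (mvfderiv_comp_mfderiv (hk.mdifferentiable (by simp) p.1.2)
      mdifferentiableAt_snd (dProj p ξ)))
  refine ⟨D, hD, fun p ↦ ?_, hDe'⟩
  obtain ⟨ξ, hξ⟩ := dProj_surjective p (tangentPair I p.1 1 0)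
  rw [← eulerForm_productMetric_apply hg hsymm (hD.proj p) hξ, hDe', hξ, dSnd_tangentPair,
    map_zero, neg_zero]

/-- The geodesic field of the product metric. -/
theorem exists_isGeodesicField_productMetric {g : CovTensor2 I M} (hg : IsSmoothTensor g)
    (hsymm : ∀ x v w, g x v w = g x w v)
    (hnd : ∀ x (v : TangentSpace I x), (∀ w, g x v w = 0) → v = 0) :
    ∃ Z : VField (𝓘(ℝ, ℝ).prod I).tangent (TangentBundle (𝓘(ℝ, ℝ).prod I) (ℝ × M)), IsSODE Z ∧
      (∀ p, diffFun (dotFun (dt I M)) p (Z p) = 0) ∧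
      ∀ p, eulerForm (productMetric g) p (Z p) = 0 := by
  obtain ⟨Z, hZ, hZt, hZe⟩ := exists_isSODE_productMetric hg hsymm hnd
    (contMDiff_const (c := (0 : ℝ)) (I := I))
  refine ⟨Z, hZ, hZt, fun p ↦ ContinuousLinearMap.ext fun ξ ↦ ?_⟩
  rw [hZe, mvfderiv_const]
  exact neg_zero

theorem pullbackTensor_eq_of_preserves [T2Space M] {g : CovTensor2 I M} (hg : IsSmoothTensor g)
    (hsymm : ∀ x v w, g x v w = g x w v)
    (hnd : ∀ x (v : TangentSpace I x), (∀ w, g x v w = 0) → v = 0) (φ : OneParameterGroup I M)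
    (h : PreservesEquationsOfMotion φ.frame (productMetric g) (dt I M) (productMetric g) (dt I M))
    (t : ℝ) : pullbackTensor I I (φ.map t) g = g := by
  rw [preservesEquationsOfMotion_iff] at h
  suffices hp : ∀ (p : TangentBundle (𝓘(ℝ, ℝ).prod I) (ℝ × M)) (u w : TangentSpace I p.1.2),
      g (φ.map p.1.1 p.1.2) (mfderiv I I (φ.map p.1.1) p.1.2 u)
        (mfderiv I I (φ.map p.1.1) p.1.2 w) = g p.1.2 u w from
    funext fun a ↦ ContinuousLinearMap.ext fun u ↦ ContinuousLinearMap.ext fun w ↦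
      hp ⟨(t, a), 0⟩ u w
  intro p u w
  set q := tangentMap (𝓘(ℝ, ℝ).prod I) (𝓘(ℝ, ℝ).prod I) φ.frame p with hq
  let U : TangentSpace I q.1.2 := mfderiv I I (φ.map p.1.1) p.1.2 u
  obtain ⟨k, hk, hkd⟩ := exists_contMDiff_mvfderiv_eq (I := I) q.1.2 (-g q.1.2 U)
  obtain ⟨D, hD, hDt, hDe⟩ := exists_isSODE_productMetric hg hsymm hnd hk
  obtain ⟨Z, hZ, hZt, hZe⟩ := exists_isGeodesicField_productMetric hg hsymm hnd
  obtain ⟨D₁, hD₁⟩ := exists_isPushforward φ.frame D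
  obtain ⟨Z₁, hZ₁⟩ := exists_isPushforward φ.frame Z
  have hvert : D q - Z q = verticalLift q (tangentPair I q.1 0 U) := by
    obtain ⟨Y, hY⟩ := exists_sub_eq_verticalLift ((hD.proj q).trans (hZ.proj q).symm)
    rw [hY]
    congr 1
    rw [← sub_eq_zero]
    refine productMetric_nondegenerate hnd _ _ fun v ↦ ?_
    obtain ⟨ξ, rfl⟩ := dProj_surjective q v
    rw [map_sub, sub_apply, ← contractExtDeriv_verticalLift hg.productMetric, ← hY, ← eulerForm_sub,
      sub_apply, hDe, hZe, hkd, productMetric_apply, dt_tangentPair, dSnd_tangentPair,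
      zero_apply, neg_apply]
    ring
  have hvert₁ : D₁ p - Z₁ p = verticalLift p (tangentPair I p.1 0 u) := by
    apply (mfderiv_tangentMap_bijective φ.frame p).1
    rw [map_sub, hD₁ p, hZ₁ p, hvert, mfderiv_tangentMap_verticalLift φ.frame.contMDiff]
    exact congrArg (verticalLift q) (mfderiv_frame_tangentPair φ p.1 u).symm
  obtain ⟨c, hc⟩ := h D hD hDt D₁ hD₁ p
  obtain ⟨c', hc'⟩ := h Z hZ hZt Z₁ hZ₁ p
  obtain ⟨ξ, hξ⟩ := dProj_surjective p (tangentPair I p.1 0 w)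
  have e1 := hc ξ
  have e2 := hc' ξ
  rw [hξ, dt_tangentPair, mul_zero] at e1 e2
  have e3 : eulerForm (productMetric g) p (D₁ p) ξ - eulerForm (productMetric g) p (Z₁ p) ξ
      = g p.1.2 u w := by
    rw [← sub_apply, eulerForm_sub, hvert₁, contractExtDeriv_verticalLift_tangentPair hg, hξ,
      dSnd_tangentPair]
  have e4 : ∀ η, eulerForm (productMetric g) q (D q) η - eulerForm (productMetric g) q (Z q) η
      = g q.1.2 U (dSnd I q.1 (dProj q η)) := by
    intro η
    rw [← sub_apply, eulerForm_sub, hvert, contractExtDeriv_verticalLift_tangentPair hg]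
  have e5 := (e4 (mfderiv (𝓘(ℝ, ℝ).prod I).tangent (𝓘(ℝ, ℝ).prod I).tangent
    (tangentMap (𝓘(ℝ, ℝ).prod I) (𝓘(ℝ, ℝ).prod I) φ.frame) p ξ)).trans
    (congrArg (g q.1.2 U) (dSnd_dProj_tangentMap_frame φ p hξ))
  change _ = g (φ.map p.1.1 p.1.2) _ _ at e5
  rw [← e5, ← e3]
  linarith

theorem isInertial_of_preserves {g : CovTensor2 I M} (hg : IsSmoothTensor g)
    (hsymm : ∀ x v w, g x v w = g x w v)
    (hnd : ∀ x (v : TangentSpace I x), (∀ w, g x v w = 0) → v = 0) (φ : OneParameterGroup I M)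
    (h : PreservesEquationsOfMotion φ.frame (productMetric g) (dt I M) (productMetric g) (dt I M)) :
    IsInertial φ.frame (productMetric g) (productMetric g) := by
  rw [preservesEquationsOfMotion_iff] at h
  have hG := hg.productMetric
  have hGn := productMetric_nondegenerate hnd
  obtain ⟨Z, hZ, hZt, hZe⟩ := exists_isGeodesicField_productMetric hg hsymm hnd
  obtain ⟨Z₁, hZ₁⟩ := exists_isPushforward φ.frame Z
  have heq : ∀ p, Z₁ p = Z p := by
    intro p
    obtain ⟨Y, hY⟩ := exists_sub_eq_verticalLift ((hZ₁.dProj_eq hZ p).trans (hZ.proj p).symm)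
    obtain ⟨c, hc⟩ := h Z hZ hZt Z₁ hZ₁ p
    have h1 : ∀ v, productMetric g p.1 Y v = c * dt I M p.1 v := by
      intro v
      obtain ⟨ξ, rfl⟩ := dProj_surjective p v
      rw [← hc, ← contractExtDeriv_verticalLift hG, ← hY, ← eulerForm_sub, hZe, hZe, sub_zero,
        zero_apply, sub_zero]
    have h2 : dt I M p.1 Y = 0 := by
      rw [← diffFun_dotFun_dt_verticalLift, ← hY, map_sub, hZt,
        ← diffFun_dotFun_dt_tangentMap_frame φ, hZ₁ p, hZt, sub_zero]
    have h3 : c = 0 := by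
      have := h1 (tangentPair I p.1 1 0)
      rw [productMetric_apply, h2, dt_tangentPair, dSnd_tangentPair, map_zero] at this
      linarith
    have h4 : Y = 0 := hGn _ _ fun v ↦ by rw [h1, h3, zero_mul]
    rw [← sub_eq_zero, hY, h4, verticalLift_zero]
  refine ⟨Z, Z, ⟨hZ, fun p ↦ ContinuousLinearMap.ext fun ξ ↦ ?_⟩, ⟨hZ, hZe⟩,
    fun p ↦ (sub_self _).symm⟩
  refine (eulerForm_pullback hG φ.frame.contMDiff p (Z p) ξ).trans ?_
  rw [← heq, hZ₁ p, hZe]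
  rfl

end Frame

end InertialFrames

end

theorem mainTheorem4 {E : Type*} [NormedAddCommGroup E] [NormedSpace ℝ E] [FiniteDimensional ℝ E]
    {M : Type*} [TopologicalSpace M] [T2Space M] [ChartedSpace E M] [IsManifold 𝓘(ℝ, E) ∞ M]
    (g : InertialFrames.PseudoRiemannianMetric 𝓘(ℝ, E) M)
    (φ : InertialFrames.OneParameterGroup 𝓘(ℝ, E) M) :
    InertialFrames.PreservesEquationsOfMotion φ.frame
        (InertialFrames.productMetric g.val) (InertialFrames.dt 𝓘(ℝ, E) M)
        (InertialFrames.productMetric g.val) (InertialFrames.dt 𝓘(ℝ, E) M) ↔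
      InertialFrames.IsInertial φ.frame
        (InertialFrames.productMetric g.val) (InertialFrames.productMetric g.val) ∧
        ∀ t : ℝ, InertialFrames.pullbackTensor 𝓘(ℝ, E) 𝓘(ℝ, E) (φ.map t) g.val = g.val := by
  have hg : InertialFrames.IsSmoothTensor g.val :=
    InertialFrames.isSmoothTensor_of_contMDiff g.contMDiff
  exact ⟨fun h ↦ ⟨InertialFrames.isInertial_of_preserves hg g.symm g.nondegenerate φ h,
    InertialFrames.pullbackTensor_eq_of_preserves hg g.symm g.nondegenerate φ h⟩,
    fun h ↦ InertialFrames.preserves_of_isInertial hg g.symm φ h.1 h.2⟩
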